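/- Let $n,p\ge 0$ be integers and let $a,c\in\mathbb R$, $c>0$. Regard $M=S^{2n+1}\times S^{2p+1}\subset\mathbb C^{n+1}\times\mathbb C^{p+1}$ as the homogeneous space $U(n+1)/U(n)\times U(p+1)/U(p)$, with base point $o=(e_0,e_0)$. With $E_{\nu\mu}$ the matrix units (indices starting at $0$), let $\mathfrak p_1\subset\mathfrak u(n+1)$ be the complement of $\mathfrak u(n)$ with basis $X^1=iE_{00}$, $Y^1_{2\nu-1}=E_{\nu0}-E_{0\nu}$, $Y^1_{2\nu}=i(E_{\nu0}+E_{0\nu})$, $1\le\nu\le n$, let $\mathfrak p_2\subset\mathfrak u(p+1)$ with basis $X^2$, $Y^2_1,\dots,Y^2_{2p}$ be defined in the same way, and let $\mathfrak p=\mathfrak p_1\times\mathfrak p_2\cong T_oM$ (an element $X\in\mathfrak p$ corresponds to the tangent vector $X\cdot o$). On $\mathfrak p$ put $$\omega=X^1\wedge X^2+\sum_{\nu=1}^nY^1_{2\nu-1}\wedge Y^1_{2\nu}+\sum_{\nu=1}^pY^2_{2\nu-1}\wedge Y^2_{2\nu}$$ (the wedge products being those of the dual basis, with $(X^1\wedge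 X^2)(X^1,X^2)=1$), and let $I=I(a,c)$ be the linear map with $$IX^1=\tfrac acX^1+\tfrac1cX^2,\quad IX^2=-\tfrac{a^2+c^2}cX^1-\tfrac acX^2,\quad IY^k_{2\nu-1}=Y^k_{2\nu},\quad IY^k_{2\nu}=-Y^k_{2\nu-1}.$$ Let $g(a,c)$ be the $U(n+1)\times U(p+1)$-invariant Riemannian metric on $M$ with $g(a,c)(X,Y)=\omega(X,I(a,c)Y)$ on $\mathfrak p$. Then: 1) In the basis $X^1,Y^1_1,\dots,Y^1_{2n},X^2,Y^2_1,\dots,Y^2_{2p}$ of $\mathfrak p$ (and, by invariance, in the translate of this basis by $(A,B)$ at every point $(A,B)\cdot o$, $A\in U(n+1)$, $B\in U(p+1)$), the matrix of the Ricci tensor of $g(a,c)$, as a bilinear form, is $$Ric(a,c)=\begin{pmatrix}r_{11}&r_{12}\\ r_{12}^{\top}&r_{22}\end{pmatrix},\quad r_{11}=\begin{pmatrix}x&0\\0&2\left(1+n-\frac1c\right)E_{2n}\end{pmatrix},\quad r_{22}=\begin{pmatrix}y&0\\0&2\left(1+p-\frac{a^2+c^2}c\right)E_{2p}\end{pmatrix},\quad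 r_{12}=\begin{pmatrix}z&0\\0&0\end{pmatrix},$$ where $E_m$ is the unit $m\times m$ matrix and $$x=2\,\frac{n+pa^2}{c^2},\qquad y=2\,\frac{na^2+p(a^2+c^2)^2}{c^2},\qquad z=-2\,\frac a{c^2}\left(n+p(a^2+c^2)\right).$$ The eigenvalues of this matrix, with multiplicity, are $$\tilde r_{1,2}=\frac{x+y\pm\sqrt{(x-y)^2+4z^2}}2,$$ $\tilde r_3=\dots=\tilde r_{2n+2}=2\left(1+n-\frac1c\right)$ ($2n$ times) and $\tilde r_{2n+3}=\dots=\tilde r_{2n+2p+2}=2\left(1+p-\frac{a^2+c^2}c\right)$ ($2p$ times). 2) The scalar curvature of $g(a,c)$ is (at every point) $$s=4n\left(1+n-\frac1{2c}\right)+4p\left(1+p-\frac{a^2+c^2}{2c}\right).$$ -/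

import Mathlib

open scoped Matrix Kronecker

noncomputable section

namespace SphereProduct

/-! ### Index set of the basis `X¹, Y¹₁, …, Y¹₂ₙ, X², Y²₁, …, Y²₂ₚ` -/

/-- Index set of the basis of `𝔭₁`: `inl ()` stands for `X¹`, and (counting `ν` from `0`)
`inr (ν, 0)`, `inr (ν, 1)` stand for `Y¹_{2ν+1}`, `Y¹_{2ν+2}`. -/
abbrev Half (n : ℕ) := Unit ⊕ (Fin n × Fin 2)

/-- Index set of the basis of `𝔭 = 𝔭₁ × 𝔭₂`. -/
abbrev Idx (n p : ℕ) := Half n ⊕ Half p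

/-! ### The Lie algebra side -/

/-- `Z_{νμ} = E_{νμ} - E_{μν}`. -/
def Zmat {n : ℕ} (ν μ : Fin (n + 1)) : Matrix (Fin (n + 1)) (Fin (n + 1)) ℂ :=
  Matrix.single ν μ 1 - Matrix.single μ ν 1

/-- `T_{νμ} = E_{νμ} + E_{μν}`. -/
def Tmat {n : ℕ} (ν μ : Fin (n + 1)) : Matrix (Fin (n + 1)) (Fin (n + 1)) ℂ :=
  Matrix.single ν μ 1 + Matrix.single μ ν 1

/-- The basis `X = ½ i T₀₀`, `Y_{2ν-1} = Z_{ν0}`, `Y_{2ν} = i T_{ν0}` of the complement of `𝔲(n)`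
in `𝔲(n+1)`. -/
def halfBasis {n : ℕ} : Half n → Matrix (Fin (n + 1)) (Fin (n + 1)) ℂ
  | Sum.inl _ => (1 / 2 : ℂ) • Complex.I • Tmat 0 0
  | Sum.inr (ν, k) => if k = 0 then Zmat ν.succ 0 else Complex.I • Tmat ν.succ 0

/-- The basis `X¹, Y¹, X², Y²` of `𝔭`, inside `𝔲(n+1) × 𝔲(p+1)`. -/
def pBasis {n p : ℕ} : Idx n p →
    Matrix (Fin (n + 1)) (Fin (n + 1)) ℂ × Matrix (Fin (p + 1)) (Fin (p + 1)) ℂ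
  | Sum.inl i => (halfBasis i, 0)
  | Sum.inr i => (0, halfBasis i)

/-- A block with the number `x` in the `(X, X)` corner and the matrix `M` in the `(Y, Y)` part. -/
def corner {n p : ℕ} (x : ℝ) (M : Matrix (Fin n × Fin 2) (Fin p × Fin 2) ℝ) :
    Matrix (Half n) (Half p) ℝ :=
  Matrix.fromBlocks (Matrix.of fun _ _ => x) 0 0 M

/-- The matrix `ω(eᵢ, eⱼ)` of `ω = X¹ ∧ X² + ∑ Y¹_{2ν-1} ∧ Y¹_{2ν} + ∑ Y²_{2ν-1} ∧ Y²_{2ν}`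
on `𝔭`. -/
def omegaP (n p : ℕ) : Matrix (Idx n p) (Idx n p) ℝ :=
  Matrix.fromBlocks
    (corner 0 ((1 : Matrix (Fin n) (Fin n) ℝ) ⊗ₖ !![0, 1; -1, 0])) (corner 1 0)
    (corner (-1) 0) (corner 0 ((1 : Matrix (Fin p) (Fin p) ℝ) ⊗ₖ !![0, 1; -1, 0]))

/-- The matrix of `I(a,c)` on `𝔭` (the `j`-th column holds the coordinates of `I(a,c) eⱼ`). -/
def complexP (n p : ℕ) (a c : ℝ) : Matrix (Idx n p) (Idx n p) ℝ :=
  Matrix.fromBlocks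
    (corner (a / c) ((1 : Matrix (Fin n) (Fin n) ℝ) ⊗ₖ !![0, -1; 1, 0]))
    (corner (-(a ^ 2 + c ^ 2) / c) 0)
    (corner (1 / c) 0)
    (corner (-a / c) ((1 : Matrix (Fin p) (Fin p) ℝ) ⊗ₖ !![0, -1; 1, 0]))

/-! ### The manifold `S²ⁿ⁺¹ × S²ᵖ⁺¹` and its invariant structures -/

/-- The ambient space `ℂⁿ⁺¹ × ℂᵖ⁺¹`. -/
abbrev Amb (n p : ℕ) := (Fin (n + 1) → ℂ) × (Fin (p + 1) → ℂ)

/-- The Hermitian product of `ℂⁿ⁺¹`, conjugate linear in the first argument. -/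
def herm {n : ℕ} (z u : Fin (n + 1) → ℂ) : ℂ := star z ⬝ᵥ u

/-- The manifold `S²ⁿ⁺¹ × S²ᵖ⁺¹`. -/
def sphereProd (n p : ℕ) : Set (Amb n p) := {q | herm q.1 q.1 = 1 ∧ herm q.2 q.2 = 1}

/-- The base point `e₀`, with stabilizer `U(n)` in `U(n+1)`. -/
def e0 (n : ℕ) : Fin (n + 1) → ℂ := Pi.single 0 1

/-- The point `(A, B) · o`. -/
def orbitPt {n p : ℕ} (A : Matrix.unitaryGroup (Fin (n + 1)) ℂ)
    (B : Matrix.unitaryGroup (Fin (p + 1)) ℂ) : Amb n p :=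
  (A.1 *ᵥ e0 n, B.1 *ᵥ e0 p)

/-- The tangent vector at `(A, B) · o` that corresponds to the `i`-th basis vector of `𝔭`:
the velocity at `t = 0` of the curve `(A, B) exp (t eᵢ) · o`. -/
def frame {n p : ℕ} (A : Matrix.unitaryGroup (Fin (n + 1)) ℂ)
    (B : Matrix.unitaryGroup (Fin (p + 1)) ℂ) (i : Idx n p) : Amb n p :=
  ((A.1 * (pBasis i).1) *ᵥ e0 n, (B.1 * (pBasis i).2) *ᵥ e0 p)

/-- The coefficient of `i z` in the decomposition `T_z S²ⁿ⁺¹ = ℝ i z ⊕ z^⊥`. -/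
def vert {n : ℕ} (z u : Fin (n + 1) → ℂ) : ℝ := (herm z u).im

/-- The component of `u` in the complex orthogonal complement of `z`. -/
def horiz {n : ℕ} (z u : Fin (n + 1) → ℂ) : Fin (n + 1) → ℂ := u - herm z u • z

/-- The invariant 2-form `ω` at the point `q`. -/
def omega {n p : ℕ} (q ξ η : Amb n p) : ℝ :=
  vert q.1 ξ.1 * vert q.2 η.2 - vert q.2 ξ.2 * vert q.1 η.1
    + (herm (horiz q.1 ξ.1) (horiz q.1 η.1)).im + (herm (horiz q.2 ξ.2) (horiz q.2 η.2)).im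

/-- The invariant complex structure `I(a,c)` at the point `q`. -/
def cplx {n p : ℕ} (a c : ℝ) (q ξ : Amb n p) : Amb n p :=
  ((a / c * vert q.1 ξ.1 - (a ^ 2 + c ^ 2) / c * vert q.2 ξ.2) • Complex.I • q.1
      + Complex.I • horiz q.1 ξ.1,
   (1 / c * vert q.1 ξ.1 - a / c * vert q.2 ξ.2) • Complex.I • q.2
      + Complex.I • horiz q.2 ξ.2)

/-- The invariant metric `g(a,c)(ξ, η) = ω(ξ, I(a,c) η)` at the point `q`. -/
def metric {n p : ℕ} (a c : ℝ) (q ξ η : Amb n p) : ℝ := omega q ξ (cplx a c q η)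

/-! ### Local coordinates -/

/-- The local parametrization `(θ, y) ↦ e^{iθ} (1, y) / √(1 + |y|²)` of `S²ⁿ⁺¹` at `e₀`. -/
def hopf {n : ℕ} (t : Half n → ℝ) : Fin (n + 1) → ℂ :=
  (Complex.exp (Complex.I * (t (Sum.inl ()) : ℂ))
      / ((√(1 + ∑ j, t (Sum.inr j) ^ 2) : ℝ) : ℂ)) •
    (Fin.cons 1 (fun ν : Fin n => (t (Sum.inr (ν, 0)) : ℂ) + Complex.I * (t (Sum.inr (ν, 1)) : ℂ)) :
      Fin (n + 1) → ℂ)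

/-- The local parametrization of `S²ⁿ⁺¹ × S²ᵖ⁺¹` at the point `(A, B) · o`. -/
def chart {n p : ℕ} (A : Matrix.unitaryGroup (Fin (n + 1)) ℂ)
    (B : Matrix.unitaryGroup (Fin (p + 1)) ℂ) (t : Idx n p → ℝ) : Amb n p :=
  (A.1 *ᵥ hopf (fun i => t (Sum.inl i)), B.1 *ᵥ hopf (fun i => t (Sum.inr i)))

/-- The partial derivative `∂ᵢ f`. -/
def pd {ι F : Type*} [Fintype ι] [DecidableEq ι] [NormedAddCommGroup F] [NormedSpace ℝ F]
    (i : ι) (f : (ι → ℝ) → F) (x : ι → ℝ) : F :=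
  fderiv ℝ f x (Pi.single i 1)

/-- The components of the metric `g(a,c)` in the local coordinates of `chart A B`. -/
def coordMetric {n p : ℕ} (a c : ℝ) (A : Matrix.unitaryGroup (Fin (n + 1)) ℂ)
    (B : Matrix.unitaryGroup (Fin (p + 1)) ℂ) (x : Idx n p → ℝ) :
    Matrix (Idx n p) (Idx n p) ℝ :=
  Matrix.of fun i j => metric a c (chart A B x) (pd i (chart A B) x) (pd j (chart A B) x)

/-! ### Curvature in local coordinates -/

section Curvature

variable {ι : Type*} [Fintype ι] [DecidableEq ι]

/-- The Christoffel symbols `Γᵏᵢⱼ` of the Levi-Civita connection of the metric `g`. -/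
def christoffel (g : (ι → ℝ) → Matrix ι ι ℝ) (k i j : ι) (x : ι → ℝ) : ℝ :=
  1 / 2 * ∑ l, (g x)⁻¹ k l *
    (pd i (fun y => g y j l) x + pd j (fun y => g y i l) x - pd l (fun y => g y i j) x)

/-- The components of the curvature tensor: `R(∂ᵢ, ∂ⱼ) ∂ₖ = ∑ₗ riemann g l k i j • ∂ₗ`, where
`R(X, Y) Z = D_X D_Y Z - D_Y D_X Z - D_{[X, Y]} Z`. -/
def riemann (g : (ι → ℝ) → Matrix ι ι ℝ) (l k i j : ι) (x : ι → ℝ) : ℝ :=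
  pd i (christoffel g l j k) x - pd j (christoffel g l i k) x
    + ∑ m, (christoffel g l i m x * christoffel g m j k x
      - christoffel g l j m x * christoffel g m i k x)

/-- The Ricci tensor: `Ric(Y, Z)` is the trace of `X ↦ R(X, Y) Z`. -/
def ricci (g : (ι → ℝ) → Matrix ι ι ℝ) (x : ι → ℝ) : Matrix ι ι ℝ :=
  Matrix.of fun j k => ∑ i, riemann g i k i j x

/-- The scalar curvature `s = ∑ Ricᵢⱼ gⁱʲ`. -/
def scalarCurv (g : (ι → ℝ) → Matrix ι ι ℝ) (x : ι → ℝ) : ℝ :=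
  ∑ i, ∑ j, ricci g x i j * (g x)⁻¹ i j

end Curvature



/-! ### Compatibility of the definitions

The structures on the manifold are the invariant extensions of those on `𝔭`, and the coordinate
vectors at the centre of `chart A B` are the basis vectors `X¹, Y¹, X², Y²`. -/

lemma herm_unitary {n : ℕ} (A : Matrix.unitaryGroup (Fin (n + 1)) ℂ) (u v : Fin (n + 1) → ℂ) :
    herm (A.1 *ᵥ u) (A.1 *ᵥ v) = herm u v := by
  have hA : (A.1)ᴴ * A.1 = 1 := by
    simpa [Matrix.star_eq_conjTranspose] using Unitary.star_mul_self_of_mem A.2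
  unfold herm
  rw [Matrix.star_mulVec, Matrix.dotProduct_mulVec, Matrix.vecMul_vecMul, hA, Matrix.vecMul_one]

lemma vert_unitary {n : ℕ} (A : Matrix.unitaryGroup (Fin (n + 1)) ℂ) (z u : Fin (n + 1) → ℂ) :
    vert (A.1 *ᵥ z) (A.1 *ᵥ u) = vert z u := by
  simp [vert, herm_unitary]

lemma horiz_unitary {n : ℕ} (A : Matrix.unitaryGroup (Fin (n + 1)) ℂ) (z u : Fin (n + 1) → ℂ) :
    horiz (A.1 *ᵥ z) (A.1 *ᵥ u) = A.1 *ᵥ horiz z u := by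
  simp [horiz, herm_unitary, Matrix.mulVec_sub, Matrix.mulVec_smul]

/-- `ω` is invariant under `U(n+1) × U(p+1)`. -/
lemma omega_unitary {n p : ℕ} (A : Matrix.unitaryGroup (Fin (n + 1)) ℂ)
    (B : Matrix.unitaryGroup (Fin (p + 1)) ℂ) (q ξ η : Amb n p) :
    omega (A.1 *ᵥ q.1, B.1 *ᵥ q.2) (A.1 *ᵥ ξ.1, B.1 *ᵥ ξ.2) (A.1 *ᵥ η.1, B.1 *ᵥ η.2)
      = omega q ξ η := by
  simp [omega, herm_unitary, vert_unitary, horiz_unitary]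

/-- `I(a,c)` is invariant under `U(n+1) × U(p+1)`. -/
lemma cplx_unitary {n p : ℕ} (a c : ℝ) (A : Matrix.unitaryGroup (Fin (n + 1)) ℂ)
    (B : Matrix.unitaryGroup (Fin (p + 1)) ℂ) (q ξ : Amb n p) :
    cplx a c (A.1 *ᵥ q.1, B.1 *ᵥ q.2) (A.1 *ᵥ ξ.1, B.1 *ᵥ ξ.2)
      = (A.1 *ᵥ (cplx a c q ξ).1, B.1 *ᵥ (cplx a c q ξ).2) := by
  simp [cplx, vert_unitary, horiz_unitary, Matrix.mulVec_add, Matrix.mulVec_smul]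

/-- The tangent vector at `e₀` given by a basis vector of `𝔭₁`. -/
def halfVec {n : ℕ} : Half n → (Fin (n + 1) → ℂ)
  | Sum.inl _ => Pi.single 0 Complex.I
  | Sum.inr (ν, k) => Pi.single ν.succ (if k = 0 then 1 else Complex.I)

lemma halfBasis_mulVec {n : ℕ} (i : Half n) : halfBasis i *ᵥ e0 n = halfVec i := by
  rcases i with _ | ⟨ν, k⟩
  · ext j
    refine Fin.cases ?_ (fun j => ?_) j <;>
      simp [halfBasis, halfVec, e0, Tmat, (Fin.succ_ne_zero _).symm]
    ring
  · fin_cases k <;> ext j <;> refine Fin.cases ?_ (fun j => ?_) j <;>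
      simp [halfBasis, halfVec, e0, Tmat, Zmat, Matrix.single_apply, Pi.single_apply, eq_comm]

lemma frame_inl {n p : ℕ} (A : Matrix.unitaryGroup (Fin (n + 1)) ℂ)
    (B : Matrix.unitaryGroup (Fin (p + 1)) ℂ) (i : Half n) :
    frame A B (Sum.inl i : Idx n p) = (A.1 *ᵥ halfVec i, B.1 *ᵥ 0) := by
  simp [frame, pBasis, ← halfBasis_mulVec, Matrix.mulVec_mulVec]

lemma frame_inr {n p : ℕ} (A : Matrix.unitaryGroup (Fin (n + 1)) ℂ)
    (B : Matrix.unitaryGroup (Fin (p + 1)) ℂ) (i : Half p) :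
    frame A B (Sum.inr i : Idx n p) = (A.1 *ᵥ 0, B.1 *ᵥ halfVec i) := by
  simp [frame, pBasis, ← halfBasis_mulVec, Matrix.mulVec_mulVec]

/-- `ω` is the invariant form with the prescribed values on the basis of `𝔭`. -/
lemma omega_frame {n p : ℕ} (A : Matrix.unitaryGroup (Fin (n + 1)) ℂ)
    (B : Matrix.unitaryGroup (Fin (p + 1)) ℂ) (i j : Idx n p) :
    omega (orbitPt A B) (frame A B i) (frame A B j) = omegaP n p i j := by
  rcases i with i | i <;> rcases j with j | j <;>
    simp only [frame_inl, frame_inr, orbitPt] <;>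
    rw [omega_unitary A B (e0 n, e0 p) (_, _) (_, _)] <;>
    rcases i with i | ⟨i, k⟩ <;> rcases j with j | ⟨j, l⟩ <;>
    (try fin_cases k) <;> (try fin_cases l) <;>
    simp [omega, vert, horiz, herm, halfVec, omegaP, corner, e0, Pi.single_apply,
      Matrix.one_apply, Fin.succ_ne_zero, (Fin.succ_ne_zero _).symm, eq_comm,
      Matrix.kroneckerMap_apply, dotProduct_sub, apply_ite]

lemma sum_frame {n p : ℕ} (A : Matrix.unitaryGroup (Fin (n + 1)) ℂ)
    (B : Matrix.unitaryGroup (Fin (p + 1)) ℂ) (m : Idx n p → ℝ) :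
    ∑ j, m j • frame A B j = (A.1 *ᵥ ∑ j, m (Sum.inl j) • halfVec j,
      B.1 *ᵥ ∑ j, m (Sum.inr j) • halfVec j) := by
  simp only [Fintype.sum_sum_type (f := fun j : Idx n p => m j • frame A B j), frame_inl,
    frame_inr, Matrix.mulVec_zero, Matrix.mulVec_sum, Matrix.mulVec_smul]
  ext j <;> simp [Prod.fst_sum, Prod.snd_sum]

lemma sum_halfVec {n : ℕ} (m : Half n → ℝ) :
    ∑ j, m j • halfVec j = (Fin.cons (m (Sum.inl ()) * Complex.I)
      (fun ν => (m (Sum.inr (ν, 0)) : ℂ) + m (Sum.inr (ν, 1)) * Complex.I) :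
        Fin (n + 1) → ℂ) := by
  ext j
  refine Fin.cases ?_ (fun j => ?_) j <;>
    simp [halfVec, Fintype.sum_prod_type, Finset.sum_apply, Pi.single_apply,
      (Fin.succ_ne_zero _).symm]

/-- `I(a,c)` is the invariant structure with the prescribed values on the basis of `𝔭`. -/
lemma cplx_frame {n p : ℕ} (a c : ℝ) (A : Matrix.unitaryGroup (Fin (n + 1)) ℂ)
    (B : Matrix.unitaryGroup (Fin (p + 1)) ℂ) (i : Idx n p) :
    cplx a c (orbitPt A B) (frame A B i) = ∑ j, complexP n p a c j i • frame A B j := by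
  rw [sum_frame, sum_halfVec, sum_halfVec]
  rcases i with i | i <;> simp only [frame_inl, frame_inr, orbitPt] <;>
    rw [cplx_unitary a c A B (e0 n, e0 p) (_, _)] <;> congr 2 <;>
    rcases i with i | ⟨i, k⟩ <;> (try fin_cases k) <;> ext j <;>
    refine Fin.cases ?_ (fun j => ?_) j <;>
    simp [cplx, vert, horiz, herm, halfVec, complexP, corner, e0, Pi.single_apply,
      Matrix.one_apply, Fin.succ_ne_zero, (Fin.succ_ne_zero _).symm,
      Matrix.kroneckerMap_apply] <;>
    first | (split_ifs <;> simp) | ring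

/-- The matrix of the metric `g(a,c)` in the basis `X¹, Y¹, X², Y²`. -/
lemma metric_frame {n p : ℕ} (a c : ℝ) (A : Matrix.unitaryGroup (Fin (n + 1)) ℂ)
    (B : Matrix.unitaryGroup (Fin (p + 1)) ℂ) (i j : Idx n p) :
    metric a c (orbitPt A B) (frame A B i) (frame A B j) =
      Matrix.fromBlocks (corner (1 / c) 1) (corner (-a / c) 0) (corner (-a / c) 0)
        (corner ((a ^ 2 + c ^ 2) / c) 1) i j := by
  rcases i with i | i <;> rcases j with j | j <;>
    simp only [frame_inl, frame_inr, orbitPt, metric] <;>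
    rw [cplx_unitary a c A B (e0 n, e0 p) (_, _), omega_unitary A B (e0 n, e0 p) (_, _)] <;>
    rcases i with i | ⟨i, k⟩ <;> rcases j with j | ⟨j, l⟩ <;>
    (try fin_cases k) <;> (try fin_cases l) <;>
    simp [omega, cplx, vert, horiz, herm, halfVec, corner, e0, Pi.single_apply,
      Matrix.one_apply, Fin.succ_ne_zero, (Fin.succ_ne_zero _).symm, eq_comm,
      dotProduct_sub, apply_ite, neg_div] <;>
    norm_cast

lemma herm_hopf {n : ℕ} (t : Half n → ℝ) : herm (hopf t) (hopf t) = 1 := by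
  have h0 : 0 ≤ ∑ j, t (Sum.inr j) ^ 2 := Finset.sum_nonneg fun j _ => sq_nonneg _
  set S := ∑ j, t (Sum.inr j) ^ 2 with hS
  have h1 : ((√(1 + S) : ℝ) : ℂ) * ((√(1 + S) : ℝ) : ℂ) = 1 + (S : ℂ) := by
    rw [← Complex.ofReal_mul, Real.mul_self_sqrt (by linarith)]; push_cast; rfl
  have h2 : ((√(1 + S) : ℝ) : ℂ) ≠ 0 := by
    rw [Complex.ofReal_ne_zero]; positivity
  have h3 : (starRingEnd ℂ) (Complex.exp (Complex.I * (t (Sum.inl ()) : ℂ)))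
      * Complex.exp (Complex.I * (t (Sum.inl ()) : ℂ)) = 1 := by
    rw [← Complex.exp_conj, ← Complex.exp_add]; simp
  have h4 : herm (Fin.cons 1 (fun ν : Fin n => (t (Sum.inr (ν, 0)) : ℂ)
      + Complex.I * (t (Sum.inr (ν, 1)) : ℂ)) : Fin (n + 1) → ℂ)
      (Fin.cons 1 (fun ν : Fin n => (t (Sum.inr (ν, 0)) : ℂ)
      + Complex.I * (t (Sum.inr (ν, 1)) : ℂ))) = 1 + (S : ℂ) := by
    simp only [herm, dotProduct, Fin.sum_univ_succ, hS, Fintype.sum_prod_type]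
    simp only [Pi.star_apply, Fin.cons_zero, Fin.cons_succ, star_one, mul_one]
    push_cast
    congr 1
    refine Finset.sum_congr rfl fun ν _ => ?_
    simp only [star_add, star_mul', RCLike.star_def, Complex.conj_ofReal, Complex.conj_I]
    linear_combination (-(t (Sum.inr (ν, 1)) : ℂ) ^ 2) * Complex.I_sq
  unfold hopf
  unfold herm at h4 ⊢
  rw [star_smul, smul_dotProduct, dotProduct_smul, h4, smul_smul, ← h1, smul_eq_mul,
    RCLike.star_def, map_div₀, Complex.conj_ofReal, ← hS]
  field_simp
  linear_combination h3

lemma chart_mem {n p : ℕ} (A : Matrix.unitaryGroup (Fin (n + 1)) ℂ)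
    (B : Matrix.unitaryGroup (Fin (p + 1)) ℂ) (t : Idx n p → ℝ) : chart A B t ∈ sphereProd n p := by
  simp [sphereProd, chart, herm_unitary, herm_hopf]

lemma hopf_zero {n : ℕ} : hopf (0 : Half n → ℝ) = e0 n := by
  ext j
  refine Fin.cases ?_ (fun j => ?_) j <;> simp [hopf, e0]

lemma chart_zero {n p : ℕ} (A : Matrix.unitaryGroup (Fin (n + 1)) ℂ)
    (B : Matrix.unitaryGroup (Fin (p + 1)) ℂ) : chart A B 0 = orbitPt A B := by
  simp [chart, orbitPt, ← hopf_zero]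
  exact ⟨rfl, rfl⟩

lemma differentiableAt_hopf {n : ℕ} (t : Half n → ℝ) :
    DifferentiableAt ℝ (hopf (n := n)) t := by
  have h0 : 0 ≤ ∑ j, t (Sum.inr j) ^ 2 := Finset.sum_nonneg fun j _ => sq_nonneg _
  have h1 : (1 + ∑ j, t (Sum.inr j) ^ 2) ≠ 0 := by positivity
  have h2 : ((√(1 + ∑ j, t (Sum.inr j) ^ 2) : ℝ) : ℂ) ≠ 0 := by
    rw [Complex.ofReal_ne_zero]; positivity
  have hof : ∀ f : (Half n → ℝ) → ℝ, DifferentiableAt ℝ f t →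
      DifferentiableAt ℝ (fun s => (f s : ℂ)) t := fun f hf =>
    Complex.ofRealCLM.differentiableAt.comp t hf
  have h3 : DifferentiableAt ℝ (fun s : Half n → ℝ =>
      Complex.exp (Complex.I * (s (Sum.inl ()) : ℂ))) t :=
    ((hof (fun s => s (Sum.inl ())) (by fun_prop)).const_mul Complex.I).cexp
  have h4 : DifferentiableAt ℝ (fun s : Half n → ℝ =>
      ((√(1 + ∑ j, s (Sum.inr j) ^ 2) : ℝ) : ℂ)) t :=
    hof _ (DifferentiableAt.sqrt (by fun_prop) h1)
  have h5 : DifferentiableAt ℝ (fun s : Half n → ℝ =>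
      Complex.exp (Complex.I * (s (Sum.inl ()) : ℂ))
        / ((√(1 + ∑ j, s (Sum.inr j) ^ 2) : ℝ) : ℂ)) t := by
    simp only [div_eq_mul_inv]
    exact h3.fun_mul (h4.fun_inv h2)
  unfold hopf
  refine DifferentiableAt.fun_smul (𝕜' := ℂ) (F := Fin (n + 1) → ℂ) h5 ?_
  · rw [differentiableAt_pi]
    intro j
    refine Fin.cases ?_ (fun j => ?_) j
    · simp
    · simp only [Fin.cons_succ]
      exact (hof _ (by fun_prop)).add ((hof _ (by fun_prop)).const_mul Complex.I)

lemma pd_hopf_zero {n : ℕ} (i : Half n) : pd i hopf 0 = halfVec i := by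
  unfold pd
  rw [← (differentiableAt_hopf 0).lineDeriv_eq_fderiv]
  have hof : HasDerivAt (fun s : ℝ => (s : ℂ)) 1 0 := Complex.ofRealCLM.hasDerivAt
  refine HasDerivAt.deriv (hasDerivAt_pi.2 fun j => ?_)
  rcases i with i | ⟨i, k⟩
  · have h := ((hof.const_mul Complex.I).cexp).mul_const
      ((Pi.single 0 1 : Fin (n + 1) → ℂ) j)
    have e : (fun s : ℝ => hopf ((0 : Half n → ℝ) + s • Pi.single (Sum.inl i) 1) j)
        = fun s : ℝ => Complex.exp (Complex.I * (s : ℂ)) * (Pi.single 0 1 : Fin (n + 1) → ℂ) j := by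
      ext s
      refine Fin.cases ?_ (fun j => ?_) j <;> simp [hopf]
    have e' : (halfVec (Sum.inl i) : Fin (n + 1) → ℂ) j
        = Complex.exp (Complex.I * ((0 : ℝ) : ℂ)) * (Complex.I * 1)
          * (Pi.single 0 1 : Fin (n + 1) → ℂ) j := by
      refine Fin.cases ?_ (fun j => ?_) j <;> simp [halfVec]
    rw [e, e']
    exact h
  · have h1 : HasDerivAt (fun s : ℝ => (((√(1 + s ^ 2))⁻¹ : ℝ) : ℂ)) 0 0 := by
      have h : HasDerivAt (fun s : ℝ => (√(1 + s ^ 2))⁻¹) 0 0 := by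
        have := ((((hasDerivAt_id (0 : ℝ)).pow 2).const_add 1).sqrt (by simp)).inv (by simp)
        exact (this.congr_deriv (by simp))
      simpa using h.ofReal_comp
    have h2 : HasDerivAt (fun s : ℝ => (Pi.single 0 1 : Fin (n + 1) → ℂ) j
        + (s : ℂ) * (halfVec (Sum.inr (i, k)) : Fin (n + 1) → ℂ) j)
        ((halfVec (Sum.inr (i, k)) : Fin (n + 1) → ℂ) j) 0 := by
      simpa using (hof.mul_const ((halfVec (Sum.inr (i, k)) : Fin (n + 1) → ℂ) j)).const_add
        ((Pi.single 0 1 : Fin (n + 1) → ℂ) j)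
    have e : (fun s : ℝ => hopf ((0 : Half n → ℝ) + s • Pi.single (Sum.inr (i, k)) 1) j)
        = fun s : ℝ => (((√(1 + s ^ 2))⁻¹ : ℝ) : ℂ) * ((Pi.single 0 1 : Fin (n + 1) → ℂ) j
          + (s : ℂ) * (halfVec (Sum.inr (i, k)) : Fin (n + 1) → ℂ) j) := by
      ext s
      fin_cases k <;> refine Fin.cases ?_ (fun j => ?_) j <;>
        simp [hopf, halfVec, Pi.single_apply, ite_pow, mul_comm] <;>
        (split_ifs <;> simp)
    rw [e]
    exact (h1.fun_mul h2).congr_deriv (by simp)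

/-- The coordinate vectors at the centre of `chart A B` are the basis vectors. -/
lemma pd_chart_zero {n p : ℕ} (A : Matrix.unitaryGroup (Fin (n + 1)) ℂ)
    (B : Matrix.unitaryGroup (Fin (p + 1)) ℂ) (i : Idx n p) :
    pd i (chart A B) 0 = frame A B i := by
  let LA := LinearMap.toContinuousLinearMap ((Matrix.mulVecLin A.1).restrictScalars ℝ)
  let LB := LinearMap.toContinuousLinearMap ((Matrix.mulVecLin B.1).restrictScalars ℝ)
  let P : (Idx n p → ℝ) →L[ℝ] (Half n → ℝ) :=
    ContinuousLinearMap.pi fun i => ContinuousLinearMap.proj (Sum.inl i)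
  let Q : (Idx n p → ℝ) →L[ℝ] (Half p → ℝ) :=
    ContinuousLinearMap.pi fun i => ContinuousLinearMap.proj (Sum.inr i)
  have h1 : HasFDerivAt (chart A B)
      ((LA.comp ((fderiv ℝ hopf (P 0)).comp P)).prod (LB.comp ((fderiv ℝ hopf (Q 0)).comp Q))) 0 :=
    (LA.hasFDerivAt.comp 0 ((differentiableAt_hopf (P 0)).hasFDerivAt.comp 0 P.hasFDerivAt)).prodMk
      (LB.hasFDerivAt.comp 0 ((differentiableAt_hopf (Q 0)).hasFDerivAt.comp 0 Q.hasFDerivAt))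
  unfold pd
  rw [h1.fderiv]
  have hA : ∀ v, LA v = A.1 *ᵥ v := fun v => rfl
  have hB : ∀ v, LB v = B.1 *ᵥ v := fun v => rfl
  simp only [ContinuousLinearMap.prod_apply, ContinuousLinearMap.comp_apply, map_zero, hA, hB]
  rcases i with i | i
  · have hP : P (Pi.single (Sum.inl i) 1) = Pi.single i 1 := by
      ext j; simp [P, Pi.single_apply]
    have hQ : Q (Pi.single (Sum.inl i) 1) = 0 := by
      ext j; simp [Q]
    rw [hP, hQ, frame_inl, ← pd_hopf_zero, map_zero]; rfl
  · have hP : P (Pi.single (Sum.inr i) 1) = 0 := by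
      ext j; simp [P]
    have hQ : Q (Pi.single (Sum.inr i) 1) = Pi.single i 1 := by
      ext j; simp [Q, Pi.single_apply]
    rw [hP, hQ, frame_inr, ← pd_hopf_zero, map_zero]; rfl

end SphereProduct

end

/-!
The metric `g(a,c)` is a Kaluza-Klein metric. Let `ηᵃ`, `a = 1, 2`, be the connection forms of the
two Hopf fibrations and `hₐ` the Fubini-Study metrics of their bases. In the coordinates of
`chart A B`,

  `g(a,c) = ∑ Gₐᵦ ηᵃ ηᵝ + h₁ + h₂`,

where the constant matrix `G` (`fibreMetric`) is the metric on the span of `X¹, X²`. The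
representation holds on the whole domain of the chart (`coordMetric_eq_torusMetric`): the
unitary factors drop out by invariance, and `hopf` is a complex multiple of the affine vector
`(1, w)`, whose derivative is constant, so that its vertical and horizontal parts are easily read
off.

The Ricci tensor at the centre depends on the 2-jet of the metric only (`ricci_of_jet`, with the
derivative of the inverse metric from `∂(g⁻¹) = - g⁻¹ (∂g) g⁻¹`). The 2-jets are computed by a small
calculus of sums, products and inverses (`HasJet`). At the centre the only nonzero first derivatives
are `∂ₘ g(a, j) = Kₐ(m, j)`, with the antisymmetric matrices `Kₐ = ∑ᵦ Gₐᵦ Jᵝ`, where `Jᵝ` is the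
Kähler form `Im (w̄ · w')` of the `β`-th base, and the only nonzero second derivatives are those of
the horizontal components. So the only nonzero Christoffel symbols are `Γ(k; a, j) = Kₐ(j, k)`, and
the Ricci tensor splits into blocks (`jetRicci_block`, O'Neill's formulas in this case):

  `Ric(a, b) = ⟨Kₐ, Kᵦ⟩ = (G D G)(a, b)`, with `D` the diagonal matrix of the real dimensions of the
  bases, `Ric(a, j) = 0`, and `Ric(j, k) = (dimension + 2 - 2 Gₐₐ) δ(j, k)` on the `a`-th base,

where `dimension + 2` is the Einstein constant of the Fubini-Study metric and `- 2 Gₐₐ` comes from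
the curvature of the connection (`jetRicci_torusMetric`). Eigenvalues and scalar curvature follow
from the block form, since `det G = 1`.
-/

open scoped Matrix Kronecker

noncomputable section

namespace SphereProduct

/-! ### Partial derivatives and 2-jets at the origin -/

section Jets

variable {ι : Type*} [Fintype ι] [DecidableEq ι]

lemma pd_const (k : ι) (r : ℝ) (x : ι → ℝ) : pd k (fun _ => r) x = 0 := by
  simp [pd]

lemma pd_add {f g : (ι → ℝ) → ℝ} {x : ι → ℝ} (k : ι) (hf : DifferentiableAt ℝ f x)
    (hg : DifferentiableAt ℝ g x) : pd k (fun y => f y + g y) x = pd k f x + pd k g x := by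
  simp [pd, fderiv_fun_add hf hg]

lemma pd_sub {f g : (ι → ℝ) → ℝ} {x : ι → ℝ} (k : ι) (hf : DifferentiableAt ℝ f x)
    (hg : DifferentiableAt ℝ g x) : pd k (fun y => f y - g y) x = pd k f x - pd k g x := by
  simp [pd, fderiv_fun_sub hf hg]

lemma pd_mul {f g : (ι → ℝ) → ℝ} {x : ι → ℝ} (k : ι) (hf : DifferentiableAt ℝ f x)
    (hg : DifferentiableAt ℝ g x) :
    pd k (fun y => f y * g y) x = pd k f x * g x + f x * pd k g x := by
  simp [pd, fderiv_fun_mul hf hg, add_comm, mul_comm]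

lemma pd_sum {κ : Type*} {s : Finset κ} {f : κ → (ι → ℝ) → ℝ} {x : ι → ℝ} (k : ι)
    (hf : ∀ a ∈ s, DifferentiableAt ℝ (f a) x) :
    pd k (fun y => ∑ a ∈ s, f a y) x = ∑ a ∈ s, pd k (f a) x := by
  simp [pd, fderiv_fun_sum hf]

lemma pd_inv {f : (ι → ℝ) → ℝ} {x : ι → ℝ} (k : ι) (hf : DifferentiableAt ℝ f x)
    (h0 : f x ≠ 0) : pd k (fun y => (f y)⁻¹) x = -((f x)⁻¹ * (f x)⁻¹ * pd k f x) := by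
  have h := (hasDerivAt_inv h0).comp_hasFDerivAt x hf.hasFDerivAt
  have h' : fderiv ℝ (fun y => (f y)⁻¹) x = (-(f x ^ 2)⁻¹) • fderiv ℝ f x := h.fderiv
  simp only [pd, h', smul_apply, smul_eq_mul]
  field_simp

lemma contDiff_pd {f : (ι → ℝ) → ℝ} (k : ι) (hf : ContDiff ℝ 2 f) : ContDiff ℝ 1 (pd k f) :=
  (hf.fderiv_right (m := 1) (by norm_num)).clm_apply contDiff_const

/-- `f` is twice continuously differentiable and has, at the origin, the value `f0`, the partial
derivatives `f1 k` and the second partial derivatives `f2 m k`. -/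
structure HasJet (f : (ι → ℝ) → ℝ) (f0 : ℝ) (f1 : ι → ℝ) (f2 : ι → ι → ℝ) : Prop where
  contDiff : ContDiff ℝ 2 f
  value : f 0 = f0
  first : ∀ k, pd k f 0 = f1 k
  second : ∀ m k, pd m (pd k f) 0 = f2 m k

namespace HasJet

variable {f g : (ι → ℝ) → ℝ} {f0 g0 : ℝ} {f1 g1 : ι → ℝ} {f2 g2 : ι → ι → ℝ}

lemma differentiable (h : HasJet f f0 f1 f2) : Differentiable ℝ f :=
  h.contDiff.differentiable (by norm_num)

lemma differentiable_pd (h : HasJet f f0 f1 f2) (k : ι) : Differentiable ℝ (pd k f) :=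
  (contDiff_pd k h.contDiff).differentiable (by norm_num)

lemma congr_jet (h : HasJet f f0 f1 f2) (h0 : f0 = g0) (h1 : ∀ k, f1 k = g1 k)
    (h2 : ∀ m k, f2 m k = g2 m k) : HasJet f g0 g1 g2 := by
  obtain rfl : f1 = g1 := funext h1
  obtain rfl : f2 = g2 := funext fun m => funext (h2 m)
  exact h0 ▸ h

lemma const (r : ℝ) : HasJet (fun _ : ι → ℝ => r) r 0 0 :=
  ⟨contDiff_const, rfl, fun k => pd_const k r 0, fun m k => by
    rw [show pd k (fun _ : ι → ℝ => r) = fun _ => 0 from funext (pd_const k r), pd_const]; rfl⟩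

lemma coord (i : ι) : HasJet (fun x : ι → ℝ => x i) 0 (fun k => if k = i then 1 else 0) 0 := by
  have h : ∀ k, pd k (fun x : ι → ℝ => x i) = fun _ => if k = i then 1 else 0 := by
    intro k
    funext x
    simp [pd, fderiv_apply, Pi.single_apply, eq_comm]
  exact ⟨by fun_prop, rfl, fun k => by rw [h], fun m k => by rw [h, pd_const]; rfl⟩

lemma add (hf : HasJet f f0 f1 f2) (hg : HasJet g g0 g1 g2) :
    HasJet (fun x => f x + g x) (f0 + g0) (fun k => f1 k + g1 k)
      (fun m k => f2 m k + g2 m k) := by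
  have h : ∀ k, pd k (fun x => f x + g x) = fun x => pd k f x + pd k g x := fun k =>
    funext fun x => pd_add k (hf.differentiable x) (hg.differentiable x)
  refine ⟨hf.contDiff.add hg.contDiff, by rw [hf.value, hg.value], fun k => ?_, fun m k => ?_⟩
  · simp only [h, hf.first, hg.first]
  · rw [h, pd_add m (hf.differentiable_pd k 0) (hg.differentiable_pd k 0), hf.second, hg.second]

lemma mul (hf : HasJet f f0 f1 f2) (hg : HasJet g g0 g1 g2) :
    HasJet (fun x => f x * g x) (f0 * g0) (fun k => f1 k * g0 + f0 * g1 k)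
      (fun m k => f2 m k * g0 + f1 k * g1 m + (f1 m * g1 k + f0 * g2 m k)) := by
  have h : ∀ k, pd k (fun x => f x * g x) = fun x => pd k f x * g x + f x * pd k g x := fun k =>
    funext fun x => pd_mul k (hf.differentiable x) (hg.differentiable x)
  refine ⟨hf.contDiff.mul hg.contDiff, by rw [hf.value, hg.value], fun k => ?_, fun m k => ?_⟩
  · simp only [h, hf.first, hg.first, hf.value, hg.value]
  · have hf' := hf.differentiable
    have hg' := hg.differentiable
    have hf'' := hf.differentiable_pd k
    have hg'' := hg.differentiable_pd k
    rw [h, pd_add m ((hf''.fun_mul hg') 0) ((hf'.fun_mul hg'') 0), pd_mul m (hf'' 0) (hg' 0),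
      pd_mul m (hf' 0) (hg'' 0), hf.second, hg.second, hf.first, hf.first, hg.first, hg.first,
      hf.value, hg.value]

lemma const_mul (r : ℝ) (hf : HasJet f f0 f1 f2) :
    HasJet (fun x => r * f x) (r * f0) (fun k => r * f1 k) (fun m k => r * f2 m k) :=
  ((const r).mul hf).congr_jet rfl (by simp) (by simp)

lemma mul_const (r : ℝ) (hf : HasJet f f0 f1 f2) :
    HasJet (fun x => f x * r) (f0 * r) (fun k => f1 k * r) (fun m k => f2 m k * r) :=
  (hf.mul (const r)).congr_jet rfl (by simp) (by simp)

lemma sub (hf : HasJet f f0 f1 f2) (hg : HasJet g g0 g1 g2) :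
    HasJet (fun x => f x - g x) (f0 - g0) (fun k => f1 k - g1 k)
      (fun m k => f2 m k - g2 m k) := by
  have h := hf.add (hg.const_mul (-1))
  simp only [neg_one_mul, ← sub_eq_add_neg] at h
  exact h

lemma sum {κ : Type*} (s : Finset κ) {f : κ → (ι → ℝ) → ℝ} {f0 : κ → ℝ} {f1 : κ → ι → ℝ}
    {f2 : κ → ι → ι → ℝ} (h : ∀ a, HasJet (f a) (f0 a) (f1 a) (f2 a)) :
    HasJet (fun x => ∑ a ∈ s, f a x) (∑ a ∈ s, f0 a) (fun k => ∑ a ∈ s, f1 a k)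
      (fun m k => ∑ a ∈ s, f2 a m k) := by
  classical
  induction s using Finset.induction_on with
  | empty => exact (const (ι := ι) 0).congr_jet (by simp) (by simp) (by simp)
  | insert a s ha ih =>
    simp only [Finset.sum_insert ha]
    exact (h a).add ih

/-- The 2-jet of the inverse of a function with value `1` and a critical point at the origin. -/
lemma inv_of_critical (hf : HasJet f 1 0 f2) (h0 : ∀ x, f x ≠ 0) :
    HasJet (fun x => (f x)⁻¹) 1 0 (fun m k => -f2 m k) := by
  have h : ∀ k, pd k (fun x => (f x)⁻¹) = fun x => -1 * ((f x)⁻¹ * (f x)⁻¹ * pd k f x) := fun k =>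
    funext fun x => by rw [pd_inv k (hf.differentiable x) (h0 x), neg_one_mul]
  refine ⟨hf.contDiff.inv h0, by simp [hf.value], fun k => ?_, fun m k => ?_⟩
  · simp [h, hf.first]
  · have hi : Differentiable ℝ (fun x => (f x)⁻¹) := hf.differentiable.fun_inv h0
    have hp := hf.differentiable_pd k
    rw [h, pd_mul m (by fun_prop) (by fun_prop), pd_const,
      pd_mul m (by fun_prop) (by fun_prop), hf.first, hf.second, hf.value]
    simp

lemma linear (w : ι → ℝ) : HasJet (fun x => ∑ k, x k * w k) 0 w 0 :=
  (sum Finset.univ fun k => (coord k).mul_const (w k)).congr_jet (by simp) (by simp) (by simp)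

end HasJet

end Jets

/-! ### The Ricci tensor in terms of the 2-jet of the metric -/

section Ricci

variable {ι : Type*} [Fintype ι]

/-- The Christoffel symbols `Γˡⱼₖ` computed from the inverse metric `H` and the first derivatives
`D m i j = ∂ₘ gᵢⱼ`. -/
def jetChristoffel (H : Matrix ι ι ℝ) (D : ι → ι → ι → ℝ) (l j k : ι) : ℝ :=
  1 / 2 * ∑ s, H l s * (D j k s + D k j s - D s j k)

/-- The derivative `∂ₘ Γˡⱼₖ` computed from the inverse metric `H`, the first derivatives
`D m i j = ∂ₘ gᵢⱼ` and the second derivatives `D2 m k i j = ∂ₘ ∂ₖ gᵢⱼ`. -/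
def jetChristoffelDeriv (H : Matrix ι ι ℝ) (D : ι → ι → ι → ℝ) (D2 : ι → ι → ι → ι → ℝ)
    (m l j k : ι) : ℝ :=
  1 / 2 * ∑ s, H l s * (D2 m j k s + D2 m k j s - D2 m s j k)
    - ∑ s, ∑ r, H l s * D m s r * jetChristoffel H D r j k

/-- The Ricci tensor computed from the inverse metric and the first and second derivatives of
the metric. -/
def jetRicci (H : Matrix ι ι ℝ) (D : ι → ι → ι → ℝ) (D2 : ι → ι → ι → ι → ℝ) (j k : ι) : ℝ :=
  ∑ i, (jetChristoffelDeriv H D D2 i i j k - jetChristoffelDeriv H D D2 j i i k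
    + ∑ m, (jetChristoffel H D i i m * jetChristoffel H D m j k
      - jetChristoffel H D i j m * jetChristoffel H D m i k))

lemma jetRicci_reindex {κ : Type*} [Fintype κ] (e : ι ≃ κ) (H : Matrix κ κ ℝ)
    (D : κ → κ → κ → ℝ) (D2 : κ → κ → κ → κ → ℝ) (j k : ι) :
    jetRicci (H.submatrix e e) (fun m i j => D (e m) (e i) (e j))
      (fun m k i j => D2 (e m) (e k) (e i) (e j)) j k = jetRicci H D D2 (e j) (e k) := by
  simp only [jetRicci, jetChristoffelDeriv, jetChristoffel, Matrix.submatrix_apply, ← e.sum_comp]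

variable [DecidableEq ι]

lemma differentiableAt_det {g : (ι → ℝ) → Matrix ι ι ℝ} {x : ι → ℝ}
    (hg : ∀ i j, DifferentiableAt ℝ (fun y => g y i j) x) :
    DifferentiableAt ℝ (fun y => (g y).det) x := by
  simp only [Matrix.det_apply, zsmul_eq_mul, Units.smul_def]
  exact DifferentiableAt.fun_sum fun σ _ => DifferentiableAt.const_mul
    (HasFDerivAt.finsetProd fun i _ => (hg (σ i) i).hasFDerivAt).differentiableAt _

lemma differentiableAt_matrix_inv {g : (ι → ℝ) → Matrix ι ι ℝ} {x : ι → ℝ}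
    (hg : ∀ i j, DifferentiableAt ℝ (fun y => g y i j) x) (h0 : (g x).det ≠ 0) (i j : ι) :
    DifferentiableAt ℝ (fun y => (g y)⁻¹ i j) x := by
  simp only [Matrix.inv_def, Ring.inverse_eq_inv', Matrix.smul_apply, smul_eq_mul,
    Matrix.adjugate_apply]
  refine ((differentiableAt_det hg).fun_inv h0).fun_mul (differentiableAt_det fun k l => ?_)
  by_cases h : k = j
  · subst h
    simp
  · simpa [Matrix.updateRow_apply, h] using hg k l

/-- `∂ₘ(g⁻¹) = - g⁻¹ (∂ₘ g) g⁻¹`. -/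
lemma pd_matrix_inv {g : (ι → ℝ) → Matrix ι ι ℝ} {x : ι → ℝ}
    (hg : ∀ i j, DifferentiableAt ℝ (fun y => g y i j) x) (h0 : (g x).det ≠ 0) (m : ι) :
    (Matrix.of fun i j => pd m (fun y => (g y)⁻¹ i j) x)
      = -((g x)⁻¹ * (Matrix.of fun i j => pd m (fun y => g y i j) x) * (g x)⁻¹) := by
  have hi := differentiableAt_matrix_inv hg h0
  have hu : IsUnit (g x).det := isUnit_iff_ne_zero.2 h0
  have key : (Matrix.of fun i j => pd m (fun y => (g y)⁻¹ i j) x) * g x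
      + (g x)⁻¹ * (Matrix.of fun i j => pd m (fun y => g y i j) x) = 0 := by
    ext i j
    have hev : (fun y => ∑ t, (g y)⁻¹ i t * g y t j) =ᶠ[nhds x]
        fun _ => (1 : Matrix ι ι ℝ) i j := by
      filter_upwards [(differentiableAt_det hg).continuousAt.eventually_ne h0] with y hy
      rw [← Matrix.mul_apply, Matrix.nonsing_inv_mul _ (isUnit_iff_ne_zero.2 hy)]
    have h1 : pd m (fun y => ∑ t, (g y)⁻¹ i t * g y t j) x = 0 := by
      unfold pd
      rw [hev.fderiv_eq]
      simp
    rw [pd_sum m fun t _ => (hi i t).fun_mul (hg t j)] at h1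
    simp only [pd_mul m (hi i _) (hg _ j), Finset.sum_add_distrib] at h1
    simpa [Matrix.mul_apply] using h1
  calc _ = (Matrix.of fun i j => pd m (fun y => (g y)⁻¹ i j) x) * g x * (g x)⁻¹ := by
        rw [Matrix.mul_assoc, Matrix.mul_nonsing_inv _ hu, Matrix.mul_one]
    _ = _ := by rw [eq_neg_of_add_eq_zero_left key, Matrix.neg_mul]

variable {g : (ι → ℝ) → Matrix ι ι ℝ} {g0 : Matrix ι ι ℝ} {D : ι → ι → ι → ℝ}
  {D2 : ι → ι → ι → ι → ℝ}

lemma christoffel_of_jet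
    (hg : ∀ i j, HasJet (fun x => g x i j) (g0 i j) (fun m => D m i j) (fun m k => D2 m k i j))
    (l j k : ι) : christoffel g l j k 0 = jetChristoffel g0⁻¹ D l j k := by
  have h0 : g 0 = g0 := by ext i j; exact (hg i j).value
  simp only [christoffel, jetChristoffel, h0, (hg _ _).first]

lemma pd_christoffel_of_jet
    (hg : ∀ i j, HasJet (fun x => g x i j) (g0 i j) (fun m => D m i j) (fun m k => D2 m k i j))
    (hdet : g0.det ≠ 0) (m l j k : ι) :
    pd m (christoffel g l j k) 0 = jetChristoffelDeriv g0⁻¹ D D2 m l j k := by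
  have h0 : g 0 = g0 := by ext i j; exact (hg i j).value
  have hd : (g 0).det ≠ 0 := by rwa [h0]
  have hg' : ∀ i j, DifferentiableAt ℝ (fun x => g x i j) 0 := fun i j => (hg i j).differentiable 0
  have hi := differentiableAt_matrix_inv hg' hd
  have hp : ∀ a i j, DifferentiableAt ℝ (pd a fun x => g x i j) 0 := fun a i j =>
    (hg i j).differentiable_pd a 0
  have hH : ∀ s, pd m (fun x => (g x)⁻¹ l s) 0
      = -∑ r, (∑ t, g0⁻¹ l t * D m t r) * g0⁻¹ r s := by
    intro s
    have h := congrFun (congrFun (pd_matrix_inv hg' hd m) l) s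
    simpa only [Matrix.of_apply, Matrix.neg_apply, Matrix.mul_apply, (hg _ _).first, h0] using h
  unfold christoffel
  rw [pd_mul m (differentiableAt_const _) (DifferentiableAt.fun_sum fun s _ =>
      (hi l s).fun_mul (((hp _ _ _).fun_add (hp _ _ _)).fun_sub (hp _ _ _))), pd_const,
    pd_sum m fun s _ => (hi l s).fun_mul (((hp _ _ _).fun_add (hp _ _ _)).fun_sub (hp _ _ _))]
  have hterm : ∀ s, pd m (fun x => (g x)⁻¹ l s * (pd j (fun y => g y k s) x
      + pd k (fun y => g y j s) x - pd s (fun y => g y j k) x)) 0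
      = -(∑ r, (∑ t, g0⁻¹ l t * D m t r) * g0⁻¹ r s) * (D j k s + D k j s - D s j k)
        + g0⁻¹ l s * (D2 m j k s + D2 m k j s - D2 m s j k) := by
    intro s
    rw [pd_mul m (hi l s) (((hp _ _ _).fun_add (hp _ _ _)).fun_sub (hp _ _ _)), hH,
      pd_sub m ((hp _ _ _).fun_add (hp _ _ _)) (hp _ _ _), pd_add m (hp _ _ _) (hp _ _ _)]
    simp only [(hg _ _).first, (hg _ _).second, h0]
  simp only [hterm, jetChristoffelDeriv, jetChristoffel, Finset.sum_add_distrib, zero_mul, zero_add,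
    mul_add]
  rw [add_comm, sub_eq_add_neg]
  congr 1
  simp only [neg_mul, Finset.sum_neg_distrib, mul_neg, Finset.sum_mul, Finset.mul_sum]
  congr 1
  rw [Finset.sum_comm]
  refine (Finset.sum_congr rfl fun r _ => Finset.sum_comm).trans ?_
  refine Finset.sum_comm.trans ?_
  refine Finset.sum_congr rfl fun _ _ => Finset.sum_congr rfl fun _ _ =>
    Finset.sum_congr rfl fun _ _ => ?_
  ring

/-- The Ricci tensor at the origin of the coordinates depends on the 2-jet of the metric only. -/
lemma ricci_of_jet
    (hg : ∀ i j, HasJet (fun x => g x i j) (g0 i j) (fun m => D m i j) (fun m k => D2 m k i j))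
    (hdet : g0.det ≠ 0) (j k : ι) : ricci g 0 j k = jetRicci g0⁻¹ D D2 j k := by
  simp only [ricci, Matrix.of_apply, riemann, jetRicci, pd_christoffel_of_jet hg hdet,
    christoffel_of_jet hg]

end Ricci

/-! ### Metrics of torus bundles over products of projective spaces -/

section Model

variable {ι : Type*} [Fintype ι]

/-- `1 + |w|²`, where `|w|²` is the quadratic form with matrix `E` evaluated at `x`. -/
def projDenom (E : Matrix ι ι ℝ) (x : ι → ℝ) : ℝ :=
  1 + ∑ k, x k * ∑ l, x l * E l k

/-- The component `ηᵢ` of the connection form `η = v + ∑ J(x, dx) / (1 + |w|²)` of a Hopf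
fibration, where `v` is the differential of the fibre coordinate. -/
def connForm (v : ι → ℝ) (E J : Matrix ι ι ℝ) (x : ι → ℝ) (i : ι) : ℝ :=
  v i + (∑ k, x k * J k i) * (projDenom E x)⁻¹

/-- The components of the Fubini-Study metric
`|dw|² / (1 + |w|²) - |w̄ · dw|² / (1 + |w|²)²`, where `E` is the matrix of `Re (w̄ · w')` and `J`
that of `Im (w̄ · w')`. -/
def fubiniStudy (E J : Matrix ι ι ℝ) (x : ι → ℝ) (i j : ι) : ℝ :=
  E i j * (projDenom E x)⁻¹
    - (((∑ k, x k * E k i) * ∑ k, x k * E k j) + (∑ k, x k * J k i) * ∑ k, x k * J k j)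
      * ((projDenom E x)⁻¹ * (projDenom E x)⁻¹)

variable {F : Type*} [Fintype F]

/-- The metric `∑ Gₐᵦ ηᵃ ηᵝ + ∑ₐ hₐ`, with the connection forms `ηᵃ` of a product of Hopf fibrations
and the Fubini-Study metrics `hₐ` of their bases. -/
def torusMetric (G : Matrix F F ℝ) (v : F → ι → ℝ) (E J : F → Matrix ι ι ℝ) (x : ι → ℝ) :
    Matrix ι ι ℝ :=
  Matrix.of fun i j => ∑ a, ∑ b, G a b *
      (connForm (v a) (E a) (J a) x i * connForm (v b) (E b) (J b) x j)
    + ∑ a, fubiniStudy (E a) (J a) x i j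

/-- The first derivatives at the origin of the components of `torusMetric`. -/
def torusD (G : Matrix F F ℝ) (v : F → ι → ℝ) (J : F → Matrix ι ι ℝ) (m i j : ι) : ℝ :=
  ∑ a, ∑ b, G a b * (J a m i * v b j + v a i * J b m j)

/-- The second derivatives at the origin of the components of the Fubini-Study metric. -/
def fubiniD2 (E J : Matrix ι ι ℝ) (m k i j : ι) : ℝ :=
  -(E i j * (E k m + E m k)) - (E k i * E m j + E m i * E k j + (J k i * J m j + J m i * J k j))

/-- The second derivatives at the origin of the components of `torusMetric`. -/
def torusD2 (G : Matrix F F ℝ) (E J : F → Matrix ι ι ℝ) (m k i j : ι) : ℝ :=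
  ∑ a, ∑ b, G a b * (J a k i * J b m j + J a m i * J b k j) + ∑ a, fubiniD2 (E a) (J a) m k i j

end Model

section ModelJets

variable {ι : Type*} [Fintype ι] [DecidableEq ι]

lemma hasJet_projDenom (E : Matrix ι ι ℝ) :
    HasJet (projDenom E) 1 0 (fun m k => E k m + E m k) := by
  refine ((HasJet.const 1).add (HasJet.sum Finset.univ fun k =>
    (HasJet.coord k).mul (HasJet.linear fun l => E l k))).congr_jet ?_ ?_ ?_ <;>
    simp [Finset.sum_add_distrib, add_comm]

lemma hasJet_projDenom_inv {E : Matrix ι ι ℝ} (hE : ∀ x, 0 < projDenom E x) :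
    HasJet (fun x => (projDenom E x)⁻¹) 1 0 (fun m k => -(E k m + E m k)) :=
  (hasJet_projDenom E).inv_of_critical fun x => (hE x).ne'

lemma hasJet_connForm (v : ι → ℝ) {E : Matrix ι ι ℝ} (J : Matrix ι ι ℝ)
    (hE : ∀ x, 0 < projDenom E x) (i : ι) :
    HasJet (fun x => connForm v E J x i) (v i) (fun m => J m i) 0 := by
  refine ((HasJet.const (v i)).add ((HasJet.linear fun k => J k i).mul
    (hasJet_projDenom_inv hE))).congr_jet ?_ ?_ ?_ <;> simp

lemma hasJet_fubiniStudy {E : Matrix ι ι ℝ} (J : Matrix ι ι ℝ)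
    (hE : ∀ x, 0 < projDenom E x) (i j : ι) :
    HasJet (fun x => fubiniStudy E J x i j) (E i j) 0 (fun m k => fubiniD2 E J m k i j) := by
  have hS := hasJet_projDenom_inv hE
  refine ((hS.const_mul (E i j)).sub ((((HasJet.linear fun k => E k i).mul
    (HasJet.linear fun k => E k j)).add ((HasJet.linear fun k => J k i).mul
    (HasJet.linear fun k => J k j))).mul (hS.mul hS))).congr_jet ?_ ?_ ?_ <;>
    simp [fubiniD2, -neg_add_rev]

variable {F : Type*} [Fintype F]

lemma hasJet_torusMetric (G : Matrix F F ℝ) (v : F → ι → ℝ) {E : F → Matrix ι ι ℝ}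
    (J : F → Matrix ι ι ℝ) (hE : ∀ a x, 0 < projDenom (E a) x) (i j : ι) :
    HasJet (fun x => torusMetric G v E J x i j)
      (∑ a, ∑ b, G a b * (v a i * v b j) + ∑ a, E a i j)
      (fun m => torusD G v J m i j) (fun m k => torusD2 G E J m k i j) := by
  refine ((HasJet.sum Finset.univ fun a => HasJet.sum Finset.univ fun b =>
    ((hasJet_connForm (v a) (J a) (hE a) i).mul
      (hasJet_connForm (v b) (J b) (hE b) j)).const_mul (G a b)).add
    (HasJet.sum Finset.univ fun a => hasJet_fubiniStudy (J a) (hE a) i j)).congr_jet rfl ?_ ?_ <;>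
    simp [torusD, torusD2]

end ModelJets

/-! ### The Ricci tensor of a Kaluza-Klein metric -/

section BlockForms

variable {F Y : Type*}

/-- Extension of a bilinear form of the base to the total space. -/
def baseForm (F : Type*) {Y : Type*} (M : Matrix Y Y ℝ) : Matrix (F ⊕ Y) (F ⊕ Y) ℝ :=
  Matrix.fromBlocks 0 0 0 M

lemma baseForm_inl (M : Matrix Y Y ℝ) (a : F) (i : F ⊕ Y) : baseForm F M (Sum.inl a) i = 0 := by
  rcases i with i | i <;> rfl

lemma baseForm_inl_right (M : Matrix Y Y ℝ) (a : F) (i : F ⊕ Y) :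
    baseForm F M i (Sum.inl a) = 0 := by
  rcases i with i | i <;> rfl

lemma baseForm_inr (M : Matrix Y Y ℝ) (i j : Y) :
    baseForm F M (Sum.inr i) (Sum.inr j) = M i j := rfl

/-- The differential of the fibre coordinate with index `a`. -/
def fibreForm (Y : Type*) {F : Type*} [DecidableEq F] (a : F) : F ⊕ Y → ℝ :=
  Sum.elim (Pi.single a 1) 0

end BlockForms

section BlockRicci

variable {F Y : Type*} [Fintype F] [Fintype Y] [DecidableEq Y]

/-- The Ricci tensor of a metric with the jet of a Kaluza-Klein metric at a point where the
horizontal coordinates are geodesic: `K` is half the curvature of the connection, paired with the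
metric of the fibres, and `Q` holds the second derivatives of the horizontal components. By
symmetry, `K` survives in the horizontal-vertical Christoffel symbols only, and `Q` in the
horizontal part of the Ricci tensor only. -/
lemma jetRicci_block {H : Matrix F F ℝ} {D : F ⊕ Y → F ⊕ Y → F ⊕ Y → ℝ}
    {D2 : F ⊕ Y → F ⊕ Y → F ⊕ Y → F ⊕ Y → ℝ} {K : F → Y → Y → ℝ} {Q : Y → Y → Y → Y → ℝ}
    (hK : ∀ a i j, K a j i = -K a i j)
    (hD0 : ∀ a i j, D (Sum.inl a) i j = 0)
    (hD1 : ∀ m a b, D (Sum.inr m) (Sum.inl a) (Sum.inl b) = 0)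
    (hD2 : ∀ m a j, D (Sum.inr m) (Sum.inl a) (Sum.inr j) = K a m j)
    (hD3 : ∀ m a j, D (Sum.inr m) (Sum.inr j) (Sum.inl a) = K a m j)
    (hD4 : ∀ m i j, D (Sum.inr m) (Sum.inr i) (Sum.inr j) = 0)
    (hQ0 : ∀ a k i j, D2 (Sum.inl a) k i j = 0)
    (hQ1 : ∀ m a i j, D2 m (Sum.inl a) i j = 0)
    (hQ2 : ∀ m k a j, D2 m k (Sum.inl a) j = 0)
    (hQ3 : ∀ m k i a, D2 m k i (Sum.inl a) = 0)
    (hQ4 : ∀ m k i j, D2 (Sum.inr m) (Sum.inr k) (Sum.inr i) (Sum.inr j) = Q m k i j)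
    (hQs : ∀ m k i j, Q m k i j = Q m k j i) :
    (∀ a b, jetRicci (Matrix.fromBlocks H 0 0 1) D D2 (Sum.inl a) (Sum.inl b)
      = ∑ k, ∑ l, K a k l * K b k l) ∧
    (∀ a j, jetRicci (Matrix.fromBlocks H 0 0 1) D D2 (Sum.inl a) (Sum.inr j) = 0) ∧
    (∀ a j, jetRicci (Matrix.fromBlocks H 0 0 1) D D2 (Sum.inr j) (Sum.inl a) = 0) ∧
    (∀ j k, jetRicci (Matrix.fromBlocks H 0 0 1) D D2 (Sum.inr j) (Sum.inr k)
      = 1 / 2 * ∑ i, (Q i j k i + Q i k j i - Q i i j k - Q j k i i)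
        + ∑ a, ∑ b, ∑ l, H a b * K b j l * K a k l) := by
  have g0 : ∀ a j k, jetChristoffel (Matrix.fromBlocks H 0 0 1) D (Sum.inl a) j k = 0 := by
    intro a j k
    rcases j with j | j <;> rcases k with k | k <;> simp [jetChristoffel, hD0, hD1, hD3]
    simp [hK _ j k]
  have g1 : ∀ l a b, jetChristoffel (Matrix.fromBlocks H 0 0 1) D (Sum.inr l) (Sum.inl a)
      (Sum.inl b) = 0 := by
    intro l a b
    simp [jetChristoffel, hD0, hD1, Matrix.one_apply]
  have g2 : ∀ l a j, jetChristoffel (Matrix.fromBlocks H 0 0 1) D (Sum.inr l) (Sum.inl a)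
      (Sum.inr j) = K a j l := by
    intro l a j
    simp [jetChristoffel, hD0, hD2, Matrix.one_apply, hK a j l]
    ring
  have g3 : ∀ l a j, jetChristoffel (Matrix.fromBlocks H 0 0 1) D (Sum.inr l) (Sum.inr j)
      (Sum.inl a) = K a j l := by
    intro l a j
    simp [jetChristoffel, hD0, hD2, hD3, Matrix.one_apply, hK a j l]
    ring
  have g4 : ∀ l j k, jetChristoffel (Matrix.fromBlocks H 0 0 1) D (Sum.inr l) (Sum.inr j)
      (Sum.inr k) = 0 := by
    intro l j k
    simp [jetChristoffel, hD4, Matrix.one_apply]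
  refine ⟨fun a b => ?_, fun a j => ?_, fun a j => ?_, fun j k => ?_⟩
  · simp [jetRicci, jetChristoffelDeriv, g0, g1, g2, g3, hD0, hQ0, hQ1, hQ2,
      -Finset.sum_neg_distrib]
    simp only [← Finset.sum_neg_distrib]
    rw [Finset.sum_comm]
    refine Finset.sum_congr rfl fun k _ => ?_
    refine Finset.sum_congr rfl fun l _ => ?_
    rw [hK b k l, mul_neg, neg_neg]
  · simp [jetRicci, jetChristoffelDeriv, g0, g2, g4, hD0, hD2, hD4, hQ0, hQ1, hQ2, Matrix.one_apply]
  · simp [jetRicci, jetChristoffelDeriv, g0, g1, g3, g4, hD0, hD2, hD4, hQ1, hQ2, hQ3,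
      Matrix.one_apply]
  · simp [jetRicci, jetChristoffelDeriv, g0, g2, g4, hD2, hD4, hQ0, hQ1, hQ2, hQ3, hQ4,
      Matrix.one_apply]
    rw [add_comm, ← Finset.sum_sub_distrib, ← Finset.sum_sub_distrib, ← Finset.sum_sub_distrib,
      Finset.mul_sum]
    congr 1
    refine Finset.sum_congr rfl fun i _ => ?_
    rw [hQs j i i k]
    ring

/-- The Ricci tensor of `torusMetric` at the origin. The matrices `E a` are the orthogonal
projections to the tangent spaces of the bases, whose traces are the real dimensions of the bases,
and the `J a` are their Kähler forms. -/
lemma jetRicci_torusMetric [DecidableEq F] {G : Matrix F F ℝ} (hG : Gᵀ = G) (hdet : G.det ≠ 0)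
    {E J : F → Matrix Y Y ℝ} (hE : ∀ a, (E a)ᵀ = E a) (hEE : ∀ a, E a * E a = E a)
    (hJ : ∀ a, (J a)ᵀ = -J a) (hJJ : ∀ a b, J a * (J b)ᵀ = if a = b then E a else 0) :
    Matrix.of (jetRicci (Matrix.fromBlocks G⁻¹ 0 0 1)
        (torusD G (fibreForm Y) fun a => baseForm F (J a))
        (torusD2 G (fun a => baseForm F (E a)) fun a => baseForm F (J a)))
      = Matrix.fromBlocks (G * Matrix.diagonal (fun a => (E a).trace) * G) 0 0
          (∑ a, ((E a).trace + 2 - 2 * G a a) • E a) := by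
  have hGs : ∀ a b, G b a = G a b := fun a b => congrFun (congrFun hG a) b
  have hEs : ∀ a i j, E a j i = E a i j := fun a i j => congrFun (congrFun (hE a) i) j
  have hJs : ∀ a i j, J a j i = -J a i j := fun a i j => congrFun (congrFun (hJ a) i) j
  have hJ0 : ∀ a i, J a i i = 0 := fun a i => by linarith [hJs a i i]
  have hJJ' : ∀ a b i j, ∑ l, J a i l * J b j l = if a = b then E a i j else 0 := by
    intro a b i j
    have h := congrFun (congrFun (hJJ a b) i) j
    rw [Matrix.mul_apply] at h
    split_ifs at h ⊢ <;> exact h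
  have hEE' : ∀ a i j, ∑ l, E a i l * E a j l = E a i j := by
    intro a i j
    have h := congrFun (congrFun (hEE a) i) j
    simpa only [Matrix.mul_apply, hEs] using h
  obtain ⟨h1, h2, h3, h4⟩ := jetRicci_block (H := G⁻¹)
    (D := torusD G (fibreForm Y) fun a => baseForm F (J a))
    (D2 := torusD2 G (fun a => baseForm F (E a)) fun a => baseForm F (J a))
    (K := fun a i j => ∑ b, G a b * J b i j)
    (Q := torusD2 G E J)
    (fun a i j => by simp [hJs _ i j])
    (fun a i j => by simp [torusD, baseForm_inl])
    (fun m a b => by simp [torusD, baseForm_inl_right])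
    (fun m a j => by
      simp [torusD, baseForm_inl_right, baseForm_inr, fibreForm, Pi.single_apply])
    (fun m a j => by
      simp [torusD, baseForm_inl_right, baseForm_inr, fibreForm, Pi.single_apply, hGs a])
    (fun m i j => by simp [torusD, fibreForm])
    (fun a k i j => by simp [torusD2, fubiniD2, baseForm_inl, baseForm_inl_right])
    (fun m a i j => by simp [torusD2, fubiniD2, baseForm_inl, baseForm_inl_right])
    (fun m k a j => by simp [torusD2, fubiniD2, baseForm_inl, baseForm_inl_right])
    (fun m k i a => by simp [torusD2, fubiniD2, baseForm_inl_right])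
    (fun m k i j => by simp only [torusD2, fubiniD2, baseForm_inr])
    (fun m k i j => by
      simp only [torusD2]
      congr 1
      · rw [Finset.sum_comm]
        refine Finset.sum_congr rfl fun a _ => Finset.sum_congr rfl fun b _ => ?_
        rw [hGs]
        ring
      · refine Finset.sum_congr rfl fun a _ => ?_
        simp only [fubiniD2]
        rw [hEs a j i]
        ring)
  have hinv : ∀ a c, ∑ b, G⁻¹ a b * G b c = if a = c then 1 else 0 := by
    intro a c
    rw [← Matrix.mul_apply, Matrix.nonsing_inv_mul _ (isUnit_iff_ne_zero.2 hdet), Matrix.one_apply]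
  ext s t
  rcases s with a | j <;> rcases t with b | k
  · rw [Matrix.of_apply, h1, Matrix.fromBlocks_apply₁₁]
    have : ∀ k l, (∑ c, G a c * J c k l) * (∑ d, G b d * J d k l)
        = ∑ c, ∑ d, G a c * G b d * (J c k l * J d k l) := fun k l => by
      rw [Finset.sum_mul_sum]
      exact Finset.sum_congr rfl fun _ _ => Finset.sum_congr rfl fun _ _ => by ring
    simp only [this]
    have : ∀ k, ∑ l, ∑ c, ∑ d, G a c * G b d * (J c k l * J d k l)
        = ∑ c, G a c * G b c * E c k k := fun k => by
      rw [Finset.sum_comm]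
      refine Finset.sum_congr rfl fun c _ => ?_
      rw [Finset.sum_comm]
      simp only [← Finset.mul_sum, hJJ', mul_ite, mul_zero, Finset.sum_ite_eq, Finset.mem_univ,
        if_true]
    simp only [this]
    rw [Finset.sum_comm, Matrix.mul_apply]
    simp only [← Finset.mul_sum, Matrix.mul_diagonal, Matrix.trace,
      Matrix.diag_apply]
    refine Finset.sum_congr rfl fun c _ => ?_
    rw [hGs b c]
    ring
  · simp [h2]
  · simp [h3]
  · rw [Matrix.of_apply, h4, Matrix.fromBlocks_apply₂₂]
    -- A sum over `i` of second derivatives reduces to the contractions `X` of the products of two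
    -- connection forms and `U` of the Fubini-Study part.
    have hsum : ∀ (X : F → F → Y → ℝ) (U : F → Y → ℝ) (r : ℝ) (w : F → ℝ),
        (∀ a b, ∑ i, X a b i = r * if a = b then E a j k else 0) →
        (∀ a, ∑ i, U a i = w a * E a j k) →
        ∑ i, (∑ a, ∑ b, G a b * X a b i + ∑ a, U a i) = ∑ a, (r * G a a + w a) * E a j k := by
      intro X U r w hX hU
      rw [Finset.sum_add_distrib, Finset.sum_comm, Finset.sum_comm (f := fun i a => U a i),
        ← Finset.sum_add_distrib]
      refine Finset.sum_congr rfl fun a _ => ?_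
      rw [Finset.sum_comm]
      simp only [← Finset.mul_sum, hX, hU, mul_ite, mul_zero, Finset.sum_ite_eq, Finset.mem_univ,
        if_true]
      ring
    have q1 : ∑ i, torusD2 G E J i j k i = ∑ a, (-1 * G a a + -((E a).trace + 2)) * E a j k := by
      refine hsum _ _ _ _ (fun a b => ?_) (fun a => ?_)
      · simp only [hJ0, mul_zero, zero_add, hJs a k, neg_mul, Finset.sum_neg_distrib, hJJ',
          hEs a j k, one_mul]
      · have : ∀ i, fubiniD2 (E a) (J a) i j k i = -3 * (E a k i * E a j i) - E a j k * E a i i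
            + J a k i * J a j i := fun i => by
          simp only [fubiniD2]
          rw [hEs a j i, hEs a k i, hJs a k i, hJ0]
          ring
        simp only [this, Finset.sum_add_distrib, Finset.sum_sub_distrib, ← Finset.mul_sum, hEE',
          hJJ', if_true, hEs a j k, Matrix.trace, Matrix.diag_apply]
        ring
    have q2 : ∑ i, torusD2 G E J i k j i = ∑ a, (-1 * G a a + -((E a).trace + 2)) * E a j k := by
      refine hsum _ _ _ _ (fun a b => ?_) (fun a => ?_)
      · simp only [hJ0, mul_zero, zero_add, hJs a j, neg_mul, Finset.sum_neg_distrib, hJJ', one_mul]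
      · have : ∀ i, fubiniD2 (E a) (J a) i k j i = -3 * (E a j i * E a k i) - E a k j * E a i i
            + J a j i * J a k i := fun i => by
          simp only [fubiniD2]
          rw [hEs a j i, hEs a k i, hJs a j i, hJ0]
          ring
        simp only [this, Finset.sum_add_distrib, Finset.sum_sub_distrib, ← Finset.mul_sum, hEE',
          hJJ', if_true, hEs a j k, Matrix.trace, Matrix.diag_apply]
        ring
    have q3 : ∑ i, torusD2 G E J i i j k
        = ∑ a, (2 * G a a + -(2 * (E a).trace + 4)) * E a j k := by
      refine hsum _ _ _ _ (fun a b => ?_) (fun a => ?_)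
      · have : ∀ i, J a i j * J b i k + J a i j * J b i k = 2 * (J a j i * J b k i) := fun i => by
          rw [hJs a j i, hJs b k i]
          ring
        simp only [this, ← Finset.mul_sum, hJJ']
      · have : ∀ i, fubiniD2 (E a) (J a) i i j k = -2 * (E a j k * E a i i)
            - 2 * (E a j i * E a k i) - 2 * (J a j i * J a k i) := fun i => by
          simp only [fubiniD2]
          rw [hEs a j i, hEs a k i, hJs a j i, hJs a k i]
          ring
        simp only [this, Finset.sum_sub_distrib, ← Finset.mul_sum, hEE',
          hJJ', if_true, Matrix.trace, Matrix.diag_apply]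
        ring
    have q4 : ∑ i, torusD2 G E J j k i i
        = ∑ a, (2 * G a a + -(2 * (E a).trace + 4)) * E a j k := by
      refine hsum _ _ _ _ (fun a b => ?_) (fun a => ?_)
      · rw [Finset.sum_add_distrib, hJJ', hJJ', hEs a j k]
        ring
      · have : ∀ i, fubiniD2 (E a) (J a) j k i i = -2 * (E a j k * E a i i)
            - 2 * (E a j i * E a k i) - 2 * (J a j i * J a k i) := fun i => by
          simp only [fubiniD2]
          rw [hEs a j k]
          ring
        simp only [this, Finset.sum_sub_distrib, ← Finset.mul_sum, hEE',
          hJJ', if_true, Matrix.trace, Matrix.diag_apply]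
        ring
    -- The quadratic terms in the first derivatives: one factor `G` cancels the inverse metric.
    have q5 : ∑ a, ∑ b, ∑ l, G⁻¹ a b * (∑ c, G b c * J c j l) * (∑ d, G a d * J d k l)
        = ∑ a, G a a * E a j k := by
      refine Finset.sum_congr rfl fun a _ => ?_
      rw [Finset.sum_comm]
      have h5 : ∀ l, ∑ b, G⁻¹ a b * (∑ c, G b c * J c j l) * (∑ d, G a d * J d k l)
          = ∑ d, G a d * (J a j l * J d k l) := fun l => by
        rw [← Finset.sum_mul]
        simp only [Finset.mul_sum]
        rw [Finset.sum_comm]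
        simp only [← mul_assoc, ← Finset.sum_mul, hinv, ite_mul, one_mul, zero_mul,
          Finset.sum_ite_eq, Finset.mem_univ, if_true]
        exact Finset.sum_congr rfl fun _ _ => by ring
      simp only [h5]
      rw [Finset.sum_comm]
      simp only [← Finset.mul_sum, hJJ', mul_ite, mul_zero, Finset.sum_ite_eq, Finset.mem_univ,
        if_true]
    rw [q5, Finset.sum_sub_distrib, Finset.sum_sub_distrib, Finset.sum_add_distrib, q1, q2, q3, q4,
      Matrix.sum_apply, ← Finset.sum_add_distrib, ← Finset.sum_sub_distrib,
      ← Finset.sum_sub_distrib, Finset.mul_sum, ← Finset.sum_add_distrib]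
    refine Finset.sum_congr rfl fun a _ => ?_
    rw [Matrix.smul_apply, smul_eq_mul]
    ring

end BlockRicci

/-! ### The metric in local coordinates -/

lemma herm_add_right {n : ℕ} (z u v : Fin (n + 1) → ℂ) : herm z (u + v) = herm z u + herm z v :=
  dotProduct_add _ _ _

lemma herm_smul_right {n : ℕ} (r : ℂ) (z u : Fin (n + 1) → ℂ) : herm z (r • u) = r * herm z u :=
  dotProduct_smul _ _ _

lemma herm_sub_right {n : ℕ} (z u v : Fin (n + 1) → ℂ) : herm z (u - v) = herm z u - herm z v :=
  dotProduct_sub _ _ _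

lemma star_herm {n : ℕ} (z u : Fin (n + 1) → ℂ) : star (herm z u) = herm u z := by
  rw [herm, herm, Matrix.star_dotProduct, star_star]

lemma herm_smul_left {n : ℕ} (r : ℂ) (z u : Fin (n + 1) → ℂ) :
    herm (r • z) u = star r * herm z u := by
  rw [← star_herm, herm_smul_right, star_mul', star_herm]

lemma herm_sub_left {n : ℕ} (z u v : Fin (n + 1) → ℂ) : herm (u - v) z = herm u z - herm v z := by
  rw [← star_herm, herm_sub_right, star_sub, star_herm, star_herm]

lemma herm_add_left {n : ℕ} (z u v : Fin (n + 1) → ℂ) : herm (u + v) z = herm u z + herm v z := by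
  rw [← star_herm, herm_add_right, star_add, star_herm, star_herm]

lemma horiz_smul_I {n : ℕ} {z : Fin (n + 1) → ℂ} (hz : herm z z = 1) (r : ℝ)
    (u : Fin (n + 1) → ℂ) :
    horiz z (r • Complex.I • z + Complex.I • horiz z u) = Complex.I • horiz z u := by
  have h0 : herm z (horiz z u) = 0 := by
    rw [horiz, herm_sub_right, herm_smul_right, hz, mul_one, sub_self]
  have h1 : herm z (r • Complex.I • z + Complex.I • horiz z u) = r * Complex.I := by
    rw [← Complex.coe_smul, herm_add_right, herm_smul_right, herm_smul_right, herm_smul_right, hz,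
      h0]
    simp
  conv_lhs => rw [horiz, h1]
  rw [← Complex.coe_smul, smul_smul, add_sub_cancel_left]

lemma vert_smul_I {n : ℕ} {z : Fin (n + 1) → ℂ} (hz : herm z z = 1) (r : ℝ)
    (u : Fin (n + 1) → ℂ) :
    vert z (r • Complex.I • z + Complex.I • horiz z u) = r := by
  have h0 : herm z (horiz z u) = 0 := by
    rw [horiz, herm_sub_right, herm_smul_right, hz, mul_one, sub_self]
  rw [vert, ← Complex.coe_smul, herm_add_right, herm_smul_right, herm_smul_right, herm_smul_right,
    hz, h0]
  simp

/-- The metric in terms of the vertical and horizontal parts of tangent vectors. -/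
lemma metric_eq {n p : ℕ} {a c : ℝ} {q : Amb n p} (hq : q ∈ sphereProd n p) (ξ η : Amb n p) :
    metric a c q ξ η
      = 1 / c * (vert q.1 ξ.1 * vert q.1 η.1)
        + -a / c * (vert q.1 ξ.1 * vert q.2 η.2 + vert q.2 ξ.2 * vert q.1 η.1)
        + (a ^ 2 + c ^ 2) / c * (vert q.2 ξ.2 * vert q.2 η.2)
        + ((herm (horiz q.1 ξ.1) (horiz q.1 η.1)).re
          + (herm (horiz q.2 ξ.2) (horiz q.2 η.2)).re) := by
  simp only [metric, omega, cplx, horiz_smul_I hq.1, horiz_smul_I hq.2, vert_smul_I hq.1,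
    vert_smul_I hq.2, herm_smul_right, Complex.I_mul_im]
  ring

lemma metric_unitary {n p : ℕ} (a c : ℝ) (A : Matrix.unitaryGroup (Fin (n + 1)) ℂ)
    (B : Matrix.unitaryGroup (Fin (p + 1)) ℂ) (q ξ η : Amb n p) :
    metric a c (A.1 *ᵥ q.1, B.1 *ᵥ q.2) (A.1 *ᵥ ξ.1, B.1 *ᵥ ξ.2) (A.1 *ᵥ η.1, B.1 *ᵥ η.2)
      = metric a c q ξ η := by
  rw [metric, cplx_unitary, omega_unitary, metric]

/-- The derivative of the affine coordinate vector `(1, w)` in the direction of the `i`-th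
coordinate: `0` for the fibre coordinate, the basis vector `halfVec i` otherwise. -/
def affineDir {n : ℕ} (i : Half n) : Fin (n + 1) → ℂ := Sum.elim 0 (fun k => halfVec (Sum.inr k)) i

/-- The affine coordinate vector `(1, w)`, of which `hopf` is a complex multiple. -/
def affineVec {n : ℕ} (t : Half n → ℝ) : Fin (n + 1) → ℂ := e0 n + ∑ i, t i • affineDir i

/-- The factor `e^{iθ} / √(1 + |w|²)` of `hopf`. -/
def hopfFactor {n : ℕ} (t : Half n → ℝ) : ℂ :=
  Complex.exp (Complex.I * (t (Sum.inl ()) : ℂ))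
    * (((√(1 + ∑ j, t (Sum.inr j) ^ 2))⁻¹ : ℝ) : ℂ)

lemma affineVec_eq {n : ℕ} (t : Half n → ℝ) :
    affineVec t = (Fin.cons 1 (fun ν : Fin n => (t (Sum.inr (ν, 0)) : ℂ)
      + Complex.I * (t (Sum.inr (ν, 1)) : ℂ)) : Fin (n + 1) → ℂ) := by
  have h := sum_halfVec (Sum.elim 0 fun k => t (Sum.inr k))
  rw [Fintype.sum_sum_type] at h
  simp only [Sum.elim_inl, Sum.elim_inr, Pi.zero_apply, zero_smul, Finset.sum_const_zero,
    zero_add] at h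
  rw [affineVec, Fintype.sum_sum_type]
  simp only [affineDir, Sum.elim_inl, Sum.elim_inr, Pi.zero_apply, smul_zero,
    Finset.sum_const_zero, zero_add]
  rw [h]
  ext j
  refine Fin.cases ?_ (fun j => ?_) j <;> simp [e0, mul_comm]

lemma hopf_eq {n : ℕ} (t : Half n → ℝ) : hopf t = hopfFactor t • affineVec t := by
  rw [affineVec_eq, hopf, hopfFactor, div_eq_mul_inv, Complex.ofReal_inv]

lemma hasFDerivAt_affineVec {n : ℕ} (t : Half n → ℝ) :
    HasFDerivAt (affineVec (n := n)) (∑ i, (ContinuousLinearMap.proj (R := ℝ)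
      (φ := fun _ : Half n => ℝ) i).smulRight (affineDir i)) t := by
  have h := (ContinuousLinearMap.hasFDerivAt (∑ i, (ContinuousLinearMap.proj (R := ℝ)
      (φ := fun _ : Half n => ℝ) i).smulRight (affineDir i)) (x := t)).const_add (e0 n)
  refine h.congr_of_eventuallyEq (Filter.Eventually.of_forall fun s => ?_)
  simp [affineVec]

lemma pd_affineVec {n : ℕ} (i : Half n) (t : Half n → ℝ) :
    pd i affineVec t = affineDir i := by
  rw [pd, (hasFDerivAt_affineVec t).fderiv]
  simp [Pi.single_apply, -Fintype.sum_sum_type]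

lemma one_add_sum_sq_pos {n : ℕ} (t : Half n → ℝ) : 0 < 1 + ∑ j, t (Sum.inr j) ^ 2 := by
  have h : 0 ≤ ∑ j, t (Sum.inr j) ^ 2 := Finset.sum_nonneg fun j _ => sq_nonneg _
  linarith

/-- The differential of the fibre coordinate `θ` of `hopf`. -/
def hopfV (n : ℕ) : Half n → ℝ := Sum.elim 1 0

/-- The logarithmic derivative of `hopfFactor` has imaginary part `dθ`. Its real part, the
derivative of `log (1 / √(1 + |w|²))`, is irrelevant: it contributes a real multiple of `hopf t` to
the derivative of `hopf`, which has no vertical and no horizontal part. -/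
lemma exists_pd_hopfFactor {n : ℕ} (i : Half n) (t : Half n → ℝ) :
    DifferentiableAt ℝ (hopfFactor (n := n)) t ∧
      ∃ ρ : ℝ, pd i hopfFactor t = (ρ + hopfV n i * Complex.I) * hopfFactor t := by
  have hS := one_add_sum_sq_pos t
  have hr : DifferentiableAt ℝ (fun s : Half n → ℝ => (√(1 + ∑ j, s (Sum.inr j) ^ 2))⁻¹) t :=
    DifferentiableAt.fun_inv (h := fun s : Half n → ℝ => √(1 + ∑ j, s (Sum.inr j) ^ 2))
      (DifferentiableAt.sqrt (by fun_prop) hS.ne') (by positivity)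
  set r := fun s : Half n → ℝ => (√(1 + ∑ j, s (Sum.inr j) ^ 2))⁻¹ with hrdef
  have hr0 : r t ≠ 0 := by simp only [hrdef]; positivity
  have h1 : HasFDerivAt (fun s : Half n → ℝ => Complex.exp (Complex.I * (s (Sum.inl ()) : ℂ)))
      (Complex.exp (Complex.I * (t (Sum.inl ()) : ℂ)) • (Complex.I •
        (Complex.ofRealCLM.comp (ContinuousLinearMap.proj (R := ℝ)
          (φ := fun _ : Half n => ℝ) (Sum.inl ()))))) t :=
    (((Complex.ofRealCLM.comp (ContinuousLinearMap.proj (R := ℝ)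
          (φ := fun _ : Half n => ℝ) (Sum.inl ()))).hasFDerivAt (x := t)).const_mul
            Complex.I).cexp
  have h2 : HasFDerivAt (fun s : Half n → ℝ => ((r s : ℝ) : ℂ))
      (Complex.ofRealCLM.comp (fderiv ℝ r t)) t :=
    Complex.ofRealCLM.hasFDerivAt.comp t hr.hasFDerivAt
  have h3 : HasFDerivAt (hopfFactor (n := n)) _ t := h1.mul h2
  refine ⟨h3.differentiableAt, fderiv ℝ r t (Pi.single i 1) / r t, ?_⟩
  have hr1 : ((r t : ℝ) : ℂ) ≠ 0 := Complex.ofReal_ne_zero.2 hr0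
  have hv : (Pi.single i 1 : Half n → ℝ) (Sum.inl ()) = hopfV n i := by
    rcases i with i | i <;> simp [hopfV]
  rw [pd, h3.fderiv]
  have hr2 : ((√(1 + ∑ j, t (Sum.inr j) ^ 2) : ℝ) : ℂ)⁻¹ = ((r t : ℝ) : ℂ) := by simp [hrdef]
  simp only [hopfFactor, add_apply, smul_apply, ContinuousLinearMap.comp_apply,
    ContinuousLinearMap.proj_apply, Complex.ofRealCLM_apply, hv, smul_eq_mul, Complex.ofReal_inv,
    hr2, Complex.ofReal_div]
  field_simp

lemma exists_pd_hopf {n : ℕ} (i : Half n) (t : Half n → ℝ) :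
    ∃ ρ : ℝ, pd i hopf t
      = ((ρ : ℂ) + hopfV n i * Complex.I) • hopf t + hopfFactor t • affineDir i := by
  obtain ⟨hd, ρ, hρ⟩ := exists_pd_hopfFactor i t
  refine ⟨ρ, ?_⟩
  have h : HasFDerivAt (hopf (n := n)) _ t :=
    (hd.hasFDerivAt.smul (hasFDerivAt_affineVec t)).congr_of_eventuallyEq
      (Filter.Eventually.of_forall fun s => hopf_eq s)
  have h1 := pd_affineVec i t
  rw [pd, (hasFDerivAt_affineVec t).fderiv] at h1
  rw [pd] at hρ
  rw [pd, h.fderiv, hopf_eq]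
  simp only [add_apply, smul_apply, h1,
    ContinuousLinearMap.smulRight_apply, hρ, smul_smul]
  exact add_comm _ _

/-- The matrix of `Re (w̄ · w')`, extended by zero to the fibre coordinate. -/
def hopfE (n : ℕ) : Matrix (Half n) (Half n) ℝ := corner 0 1

/-- The matrix of `Im (w̄ · w')` on the real coordinates of `ℂⁿ`. -/
def imForm (n : ℕ) : Matrix (Fin n × Fin 2) (Fin n × Fin 2) ℝ :=
  (1 : Matrix (Fin n) (Fin n) ℝ) ⊗ₖ !![0, 1; -1, 0]

/-- The matrix of `Im (w̄ · w')`, extended by zero to the fibre coordinate. -/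
def hopfJ (n : ℕ) : Matrix (Half n) (Half n) ℝ := corner 0 (imForm n)

lemma projDenom_hopfE {n : ℕ} (t : Half n → ℝ) :
    projDenom (hopfE n) t = 1 + ∑ j, t (Sum.inr j) ^ 2 := by
  simp [projDenom, hopfE, corner, Matrix.one_apply, sq]

lemma herm_affineDir {n : ℕ} (i j : Half n) :
    herm (affineDir i) (affineDir j) = hopfE n i j + hopfJ n i j * Complex.I := by
  rcases i with i | ⟨i, k⟩ <;> rcases j with j | ⟨j, l⟩
  · simp [affineDir, herm, hopfE, hopfJ, corner]
  · simp [affineDir, herm, hopfE, hopfJ, corner]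
  · simp [affineDir, herm, hopfE, hopfJ, corner]
  · by_cases h : i = j
    · subst h
      fin_cases k <;> fin_cases l <;>
        simp [affineDir, herm, hopfE, hopfJ, corner, imForm, halfVec, Matrix.kroneckerMap_apply]
    · simp [affineDir, herm, hopfE, hopfJ, corner, imForm, halfVec, Matrix.kroneckerMap_apply,
        h]

lemma herm_affineVec_affineDir {n : ℕ} (t : Half n → ℝ) (j : Half n) :
    herm (affineVec t) (affineDir j)
      = ((∑ k, t k * hopfE n k j : ℝ) : ℂ) + ((∑ k, t k * hopfJ n k j : ℝ) : ℂ) * Complex.I := by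
  have h0 : herm (e0 n) (affineDir j) = 0 := by
    rcases j with j | j <;> simp [herm, e0, affineDir, halfVec]
  have hs : herm (∑ i, t i • affineDir i) (affineDir j) = ∑ i, t i * herm (affineDir i)
      (affineDir j) := by
    simp only [herm, star_sum, sum_dotProduct, star_smul, ← Complex.coe_smul, smul_dotProduct]
    simp
  rw [affineVec, herm_add_left, h0, zero_add, hs]
  push_cast
  rw [Finset.sum_mul, ← Finset.sum_add_distrib]
  exact Finset.sum_congr rfl fun k _ => by rw [herm_affineDir]; ring

lemma star_hopfFactor_mul {n : ℕ} (t : Half n → ℝ) :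
    star (hopfFactor t) * hopfFactor t = (((projDenom (hopfE n) t)⁻¹ : ℝ) : ℂ) := by
  have h3 : (starRingEnd ℂ) (Complex.exp (Complex.I * (t (Sum.inl ()) : ℂ)))
      * Complex.exp (Complex.I * (t (Sum.inl ()) : ℂ)) = 1 := by
    rw [← Complex.exp_conj, ← Complex.exp_add]; simp
  have h4 := Real.mul_self_sqrt (one_add_sum_sq_pos t).le
  rw [projDenom_hopfE, hopfFactor, star_mul', RCLike.star_def, Complex.conj_ofReal,
    mul_mul_mul_comm, h3, one_mul, ← Complex.ofReal_mul, ← mul_inv, h4]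

lemma herm_hopf_affineDir {n : ℕ} (t : Half n → ℝ) (j : Half n) :
    herm (hopf t) (hopfFactor t • affineDir j) = (((projDenom (hopfE n) t)⁻¹ : ℝ) : ℂ)
      * (((∑ k, t k * hopfE n k j : ℝ) : ℂ) + ((∑ k, t k * hopfJ n k j : ℝ) : ℂ) * Complex.I) := by
  rw [hopf_eq, herm_smul_left, herm_smul_right, ← mul_assoc, star_hopfFactor_mul,
    herm_affineVec_affineDir]

lemma vert_pd_hopf {n : ℕ} (t : Half n → ℝ) (i : Half n) :
    vert (hopf t) (pd i hopf t) = connForm (hopfV n) (hopfE n) (hopfJ n) t i := by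
  obtain ⟨ρ, hρ⟩ := exists_pd_hopf i t
  rw [vert, hρ, herm_add_right, herm_smul_right, herm_hopf, herm_hopf_affineDir, connForm]
  simp [-Complex.ofReal_inv, -Complex.ofReal_sum, -Fintype.sum_sum_type]
  ring

lemma horiz_pd_hopf {n : ℕ} (t : Half n → ℝ) (i : Half n) :
    horiz (hopf t) (pd i hopf t) = horiz (hopf t) (hopfFactor t • affineDir i) := by
  obtain ⟨ρ, hρ⟩ := exists_pd_hopf i t
  rw [hρ, horiz, horiz, herm_add_right, herm_smul_right, herm_hopf, mul_one]
  module

lemma herm_horiz {n : ℕ} {z : Fin (n + 1) → ℂ} (hz : herm z z = 1) (u v : Fin (n + 1) → ℂ) :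
    herm (horiz z u) (horiz z v) = herm u v - star (herm z u) * herm z v := by
  simp only [horiz, herm_sub_left, herm_sub_right, herm_smul_left, herm_smul_right, hz, star_herm]
  ring

lemma herm_horiz_pd_hopf {n : ℕ} (t : Half n → ℝ) (i j : Half n) :
    (herm (horiz (hopf t) (pd i hopf t)) (horiz (hopf t) (pd j hopf t))).re
      = fubiniStudy (hopfE n) (hopfJ n) t i j := by
  rw [horiz_pd_hopf, horiz_pd_hopf, herm_horiz (herm_hopf t), herm_hopf_affineDir,
    herm_hopf_affineDir, herm_smul_left, herm_smul_right, ← mul_assoc, star_hopfFactor_mul,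
    herm_affineDir, fubiniStudy]
  simp [-Complex.ofReal_inv, -Complex.ofReal_sum, -Fintype.sum_sum_type]
  ring

lemma pd_chart {n p : ℕ} (A : Matrix.unitaryGroup (Fin (n + 1)) ℂ)
    (B : Matrix.unitaryGroup (Fin (p + 1)) ℂ) (i : Idx n p) (t : Idx n p → ℝ) :
    pd i (chart A B) t
      = (A.1 *ᵥ Sum.elim (fun i => pd i hopf fun k => t (Sum.inl k)) 0 i,
        B.1 *ᵥ Sum.elim 0 (fun i => pd i hopf fun k => t (Sum.inr k)) i) := by
  let LA := LinearMap.toContinuousLinearMap ((Matrix.mulVecLin A.1).restrictScalars ℝ)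
  let LB := LinearMap.toContinuousLinearMap ((Matrix.mulVecLin B.1).restrictScalars ℝ)
  let P : (Idx n p → ℝ) →L[ℝ] (Half n → ℝ) :=
    ContinuousLinearMap.pi fun i => ContinuousLinearMap.proj (Sum.inl i)
  let Q : (Idx n p → ℝ) →L[ℝ] (Half p → ℝ) :=
    ContinuousLinearMap.pi fun i => ContinuousLinearMap.proj (Sum.inr i)
  have h1 : HasFDerivAt (chart A B)
      ((LA.comp ((fderiv ℝ hopf (P t)).comp P)).prod (LB.comp ((fderiv ℝ hopf (Q t)).comp Q))) t :=
    (LA.hasFDerivAt.comp t ((differentiableAt_hopf (P t)).hasFDerivAt.comp t P.hasFDerivAt)).prodMk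
      (LB.hasFDerivAt.comp t ((differentiableAt_hopf (Q t)).hasFDerivAt.comp t Q.hasFDerivAt))
  unfold pd
  rw [h1.fderiv]
  have hA : ∀ v, LA v = A.1 *ᵥ v := fun v => rfl
  have hB : ∀ v, LB v = B.1 *ᵥ v := fun v => rfl
  simp only [ContinuousLinearMap.prod_apply, ContinuousLinearMap.comp_apply, hA, hB]
  rcases i with i | i
  · have hP : P (Pi.single (Sum.inl i) 1) = Pi.single i 1 := by
      ext j; simp [P, Pi.single_apply]
    have hQ : Q (Pi.single (Sum.inl i) 1) = 0 := by
      ext j; simp [Q]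
    rw [hP, hQ, map_zero]; rfl
  · have hP : P (Pi.single (Sum.inr i) 1) = 0 := by
      ext j; simp [P]
    have hQ : Q (Pi.single (Sum.inr i) 1) = Pi.single i 1 := by
      ext j; simp [Q, Pi.single_apply]
    rw [hP, hQ, map_zero]; rfl

/-! ### The connection forms and the Fubini-Study metrics of a product -/

section Blocks

variable {ι κ : Type*} [Fintype ι] [Fintype κ]

lemma projDenom_inl (E : Matrix ι ι ℝ) (x : ι ⊕ κ → ℝ) :
    projDenom (Matrix.fromBlocks E 0 0 0) x = projDenom E fun i => x (Sum.inl i) := by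
  simp [projDenom]

lemma projDenom_inr (E : Matrix κ κ ℝ) (x : ι ⊕ κ → ℝ) :
    projDenom (Matrix.fromBlocks 0 0 0 E) x = projDenom E fun i => x (Sum.inr i) := by
  simp [projDenom]

lemma connForm_inl (v : ι → ℝ) (E J : Matrix ι ι ℝ) (x : ι ⊕ κ → ℝ) (i : ι ⊕ κ) :
    connForm (Sum.elim v 0) (Matrix.fromBlocks E 0 0 0) (Matrix.fromBlocks J 0 0 0) x i
      = Sum.elim (connForm v E J fun i => x (Sum.inl i)) 0 i := by
  rcases i with i | i <;> simp [connForm, projDenom_inl]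

lemma connForm_inr (v : κ → ℝ) (E J : Matrix κ κ ℝ) (x : ι ⊕ κ → ℝ) (i : ι ⊕ κ) :
    connForm (Sum.elim (0 : ι → ℝ) v) (Matrix.fromBlocks 0 0 0 E) (Matrix.fromBlocks 0 0 0 J) x i
      = Sum.elim (0 : ι → ℝ) (connForm v E J fun i => x (Sum.inr i)) i := by
  rcases i with i | i <;> simp [connForm, projDenom_inr]

lemma fubiniStudy_inl (E J : Matrix ι ι ℝ) (x : ι ⊕ κ → ℝ) (i j : ι ⊕ κ) :
    fubiniStudy (Matrix.fromBlocks E 0 0 0) (Matrix.fromBlocks J 0 0 0) x i j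
      = Matrix.fromBlocks (Matrix.of (fubiniStudy E J fun i => x (Sum.inl i))) 0 0 0 i j := by
  rcases i with i | i <;> rcases j with j | j <;> simp [fubiniStudy, projDenom_inl]

lemma fubiniStudy_inr (E J : Matrix κ κ ℝ) (x : ι ⊕ κ → ℝ) (i j : ι ⊕ κ) :
    fubiniStudy (Matrix.fromBlocks 0 0 0 E) (Matrix.fromBlocks 0 0 0 J) x i j
      = Matrix.fromBlocks 0 0 0 (Matrix.of (fubiniStudy E J fun i => x (Sum.inr i))) i j := by
  rcases i with i | i <;> rcases j with j | j <;> simp [fubiniStudy, projDenom_inr]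

end Blocks

/-! ### The Ricci tensor and the scalar curvature of `g(a,c)` -/

/-- Index set of the horizontal basis vectors `Y¹, Y²`. -/
abbrev BaseIdx (n p : ℕ) := (Fin n × Fin 2) ⊕ (Fin p × Fin 2)

/-- Reordering of the basis of `𝔭`: the vertical vectors `X¹, X²` before the horizontal ones. -/
def splitIdx (n p : ℕ) : Idx n p ≃ (Unit ⊕ Unit) ⊕ BaseIdx n p :=
  Equiv.sumSumSumComm Unit (Fin n × Fin 2) Unit (Fin p × Fin 2)

/-- The matrix of `g(a,c)` on the span of `X¹, X²`. -/
def fibreMetric (a c : ℝ) : Matrix (Unit ⊕ Unit) (Unit ⊕ Unit) ℝ :=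
  Matrix.fromBlocks (Matrix.of fun _ _ => 1 / c) (Matrix.of fun _ _ => -a / c)
    (Matrix.of fun _ _ => -a / c) (Matrix.of fun _ _ => (a ^ 2 + c ^ 2) / c)

/-- The orthogonal projections of the horizontal space to its two factors. -/
def baseE (n p : ℕ) : Unit ⊕ Unit → Matrix (BaseIdx n p) (BaseIdx n p) ℝ :=
  Sum.elim (fun _ => Matrix.fromBlocks 1 0 0 0) (fun _ => Matrix.fromBlocks 0 0 0 1)

/-- The forms `Im (w̄ · w')` of the two factors of the horizontal space. -/
def baseJ (n p : ℕ) : Unit ⊕ Unit → Matrix (BaseIdx n p) (BaseIdx n p) ℝ :=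
  Sum.elim (fun _ => Matrix.fromBlocks (imForm n) 0 0 0)
    (fun _ => Matrix.fromBlocks 0 0 0 (imForm p))

/-- The differentials of the two fibre coordinates. -/
def idxV (n p : ℕ) (a : Unit ⊕ Unit) (i : Idx n p) : ℝ :=
  fibreForm (BaseIdx n p) a (splitIdx n p i)

/-- Extension of a family of bilinear forms on the horizontal space by zero. -/
def idxForm {n p : ℕ} (M : Unit ⊕ Unit → Matrix (BaseIdx n p) (BaseIdx n p) ℝ)
    (a : Unit ⊕ Unit) : Matrix (Idx n p) (Idx n p) ℝ :=
  (baseForm (Unit ⊕ Unit) (M a)).submatrix (splitIdx n p) (splitIdx n p)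

lemma idxV_inl (n p : ℕ) : idxV n p (Sum.inl ()) = Sum.elim (hopfV n) 0 := by
  ext i
  rcases i with (i | i) | (i | i) <;> simp [idxV, fibreForm, splitIdx, hopfV]

lemma idxV_inr (n p : ℕ) : idxV n p (Sum.inr ()) = Sum.elim (0 : Half n → ℝ) (hopfV p) := by
  ext i
  rcases i with (i | i) | (i | i) <;> simp [idxV, fibreForm, splitIdx, hopfV]

lemma idxForm_baseE_inl (n p : ℕ) :
    idxForm (baseE n p) (Sum.inl ()) = Matrix.fromBlocks (hopfE n) 0 0 0 := by
  ext i j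
  rcases i with (i | i) | (i | i) <;> rcases j with (j | j) | (j | j) <;>
    simp [idxForm, baseForm, baseE, splitIdx, hopfE, corner]

lemma idxForm_baseE_inr (n p : ℕ) :
    idxForm (baseE n p) (Sum.inr ()) = Matrix.fromBlocks 0 0 0 (hopfE p) := by
  ext i j
  rcases i with (i | i) | (i | i) <;> rcases j with (j | j) | (j | j) <;>
    simp [idxForm, baseForm, baseE, splitIdx, hopfE, corner]

lemma idxForm_baseJ_inl (n p : ℕ) :
    idxForm (baseJ n p) (Sum.inl ()) = Matrix.fromBlocks (hopfJ n) 0 0 0 := by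
  ext i j
  rcases i with (i | i) | (i | i) <;> rcases j with (j | j) | (j | j) <;>
    simp [idxForm, baseForm, baseJ, splitIdx, hopfJ, corner]

lemma idxForm_baseJ_inr (n p : ℕ) :
    idxForm (baseJ n p) (Sum.inr ()) = Matrix.fromBlocks 0 0 0 (hopfJ p) := by
  ext i j
  rcases i with (i | i) | (i | i) <;> rcases j with (j | j) | (j | j) <;>
    simp [idxForm, baseForm, baseJ, splitIdx, hopfJ, corner]

lemma projDenom_idxForm_pos {n p : ℕ} (a : Unit ⊕ Unit) (x : Idx n p → ℝ) :
    0 < projDenom (idxForm (baseE n p) a) x := by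
  rcases a with ⟨⟩ | ⟨⟩
  · rw [idxForm_baseE_inl, projDenom_inl, projDenom_hopfE]
    exact one_add_sum_sq_pos fun i => x (Sum.inl i)
  · rw [idxForm_baseE_inr, projDenom_inr, projDenom_hopfE]
    exact one_add_sum_sq_pos fun i => x (Sum.inr i)

/-- By invariance, the components of the metric do not depend on the centre of the chart. -/
lemma coordMetric_apply {n p : ℕ} (a c : ℝ) (A : Matrix.unitaryGroup (Fin (n + 1)) ℂ)
    (B : Matrix.unitaryGroup (Fin (p + 1)) ℂ) (x : Idx n p → ℝ) (i j : Idx n p) :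
    coordMetric a c A B x i j
      = metric a c (hopf fun k => x (Sum.inl k), hopf fun k => x (Sum.inr k))
        (Sum.elim (fun i => pd i hopf fun k => x (Sum.inl k)) 0 i,
          Sum.elim 0 (fun i => pd i hopf fun k => x (Sum.inr k)) i)
        (Sum.elim (fun i => pd i hopf fun k => x (Sum.inl k)) 0 j,
          Sum.elim 0 (fun i => pd i hopf fun k => x (Sum.inr k)) j) := by
  rw [← metric_unitary a c A B, ← pd_chart, ← pd_chart]
  rfl

lemma coordMetric_eq_torusMetric {n p : ℕ} (a c : ℝ) (A : Matrix.unitaryGroup (Fin (n + 1)) ℂ)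
    (B : Matrix.unitaryGroup (Fin (p + 1)) ℂ) (x : Idx n p → ℝ) :
    coordMetric a c A B x
      = torusMetric (fibreMetric a c) (idxV n p) (idxForm (baseE n p)) (idxForm (baseJ n p)) x := by
  ext i j
  have hq : ((hopf fun k => x (Sum.inl k), hopf fun k => x (Sum.inr k)) : Amb n p)
      ∈ sphereProd n p := by
    simp [sphereProd, herm_hopf]
  have hv0 : ∀ {m : ℕ} (z : Fin (m + 1) → ℂ), vert z 0 = 0 := fun z => by simp [vert, herm]
  have hh0 : ∀ {m : ℕ} (z : Fin (m + 1) → ℂ), horiz z 0 = 0 := fun z => by simp [horiz, herm]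
  have hl : ∀ {m : ℕ} (z : Fin (m + 1) → ℂ), herm 0 z = 0 := fun z => by simp [herm]
  have hr : ∀ {m : ℕ} (z : Fin (m + 1) → ℂ), herm z 0 = 0 := fun z => by simp [herm]
  rw [coordMetric_apply, metric_eq hq]
  simp only [torusMetric, Matrix.of_apply, Fintype.sum_sum_type, Finset.univ_unique,
    Finset.sum_singleton, PUnit.default_eq_unit, idxV_inl, idxV_inr, idxForm_baseE_inl,
    idxForm_baseE_inr, idxForm_baseJ_inl, idxForm_baseJ_inr, connForm_inl, connForm_inr,
    fubiniStudy_inl, fubiniStudy_inr, fibreMetric, Matrix.fromBlocks_apply₁₁,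
    Matrix.fromBlocks_apply₁₂, Matrix.fromBlocks_apply₂₁, Matrix.fromBlocks_apply₂₂]
  rcases i with i | i <;> rcases j with j | j <;>
    simp only [Sum.elim_inl, Sum.elim_inr, Pi.zero_apply, vert_pd_hopf, herm_horiz_pd_hopf, hv0,
      hh0, hl, hr, Matrix.fromBlocks_apply₁₁, Complex.zero_re, Matrix.of_apply, Matrix.zero_apply,
      Matrix.fromBlocks_apply₁₂, Matrix.fromBlocks_apply₂₁, Matrix.fromBlocks_apply₂₂] <;>
    ring

lemma imForm_mul_transpose (n : ℕ) : imForm n * (imForm n)ᵀ = 1 := by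
  have h : !![0, 1; -1, 0] * (!![0, 1; -1, 0] : Matrix (Fin 2) (Fin 2) ℝ)ᵀ = 1 := by
    ext i j
    fin_cases i <;> fin_cases j <;> simp [Matrix.mul_apply]
  rw [imForm, ← Matrix.kroneckerMap_transpose, ← Matrix.mul_kronecker_mul, h, Matrix.transpose_one,
    Matrix.mul_one, Matrix.one_kronecker_one]

lemma imForm_transpose (n : ℕ) : (imForm n)ᵀ = -imForm n := by
  ext ⟨i, k⟩ ⟨j, l⟩
  fin_cases k <;> fin_cases l <;>
    simp [imForm, Matrix.kroneckerMap_apply, Matrix.one_apply, eq_comm]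

/-- The inverse of `fibreMetric`, a matrix of determinant `1`. -/
def fibreInv (a c : ℝ) : Matrix (Unit ⊕ Unit) (Unit ⊕ Unit) ℝ :=
  Matrix.fromBlocks (Matrix.of fun _ _ => (a ^ 2 + c ^ 2) / c) (Matrix.of fun _ _ => a / c)
    (Matrix.of fun _ _ => a / c) (Matrix.of fun _ _ => 1 / c)

lemma fibreMetric_mul_inv (a : ℝ) {c : ℝ} (hc : c ≠ 0) : fibreMetric a c * fibreInv a c = 1 := by
  ext i j
  rcases i with i | i <;> rcases j with j | j <;>
    simp [fibreMetric, fibreInv, Matrix.mul_apply] <;> field_simp <;> ring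

lemma trace_baseE_inl (n p : ℕ) : (baseE n p (Sum.inl ())).trace = 2 * n := by
  simp [baseE, Matrix.trace, mul_comm]

lemma trace_baseE_inr (n p : ℕ) : (baseE n p (Sum.inr ())).trace = 2 * p := by
  simp [baseE, Matrix.trace, mul_comm]

lemma sum_baseE (n p : ℕ) : ∑ a, baseE n p a = 1 := by
  simp [baseE, Matrix.fromBlocks_add, Matrix.fromBlocks_one]

lemma sum_smul_baseE (n p : ℕ) (r : Unit ⊕ Unit → ℝ) :
    ∑ a, r a • baseE n p a = Matrix.fromBlocks (r (Sum.inl ()) • 1) 0 0 (r (Sum.inr ()) • 1) := by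
  simp [baseE, Matrix.fromBlocks_add, Matrix.fromBlocks_smul]

lemma fibreMetric_det_ne_zero (a : ℝ) {c : ℝ} (hc : c ≠ 0) : (fibreMetric a c).det ≠ 0 :=
  (Matrix.isUnit_det_of_right_inverse (fibreMetric_mul_inv a hc)).ne_zero

lemma fibreMetric_inv (a : ℝ) {c : ℝ} (hc : c ≠ 0) : (fibreMetric a c)⁻¹ = fibreInv a c :=
  Matrix.inv_eq_right_inv (fibreMetric_mul_inv a hc)

lemma fibreMetric_transpose (a c : ℝ) : (fibreMetric a c)ᵀ = fibreMetric a c := by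
  ext i j
  rcases i with i | i <;> rcases j with j | j <;> rfl

/-- The matrix of `g(a,c)` at the centre of the chart, in the basis `X¹, X², Y¹, Y²`. -/
def splitMetric (n p : ℕ) (a c : ℝ) :
    Matrix ((Unit ⊕ Unit) ⊕ BaseIdx n p) ((Unit ⊕ Unit) ⊕ BaseIdx n p) ℝ :=
  Matrix.fromBlocks (fibreMetric a c) 0 0 1

lemma splitMetric_det_ne_zero (n p : ℕ) (a : ℝ) {c : ℝ} (hc : c ≠ 0) :
    (splitMetric n p a c).det ≠ 0 := by
  rw [splitMetric, Matrix.det_fromBlocks_zero₂₁, Matrix.det_one, mul_one]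
  exact fibreMetric_det_ne_zero a hc

lemma splitMetric_inv (n p : ℕ) (a : ℝ) {c : ℝ} (hc : c ≠ 0) :
    (splitMetric n p a c)⁻¹ = Matrix.fromBlocks (fibreMetric a c)⁻¹ 0 0 1 := by
  refine Matrix.inv_eq_right_inv ?_
  rw [splitMetric, Matrix.fromBlocks_multiply, Matrix.mul_nonsing_inv _
    (isUnit_iff_ne_zero.2 (fibreMetric_det_ne_zero a hc))]
  simp [Matrix.fromBlocks_one]

section Charts

variable {n p : ℕ} (a : ℝ) {c : ℝ} (A : Matrix.unitaryGroup (Fin (n + 1)) ℂ)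
  (B : Matrix.unitaryGroup (Fin (p + 1)) ℂ)

lemma hasJet_coordMetric (c : ℝ) (i j : Idx n p) :
    HasJet (fun x => coordMetric a c A B x i j)
      ((splitMetric n p a c).submatrix (splitIdx n p) (splitIdx n p) i j)
      (fun m => torusD (fibreMetric a c) (idxV n p) (idxForm (baseJ n p)) m i j)
      (fun m k => torusD2 (fibreMetric a c) (idxForm (baseE n p)) (idxForm (baseJ n p)) m k i j)
      := by
  simp only [coordMetric_eq_torusMetric]
  refine (hasJet_torusMetric (fibreMetric a c) (idxV n p) (idxForm (baseJ n p))
    projDenom_idxForm_pos i j).congr_jet ?_ (fun _ => rfl) fun _ _ => rfl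
  simp only [idxV, idxForm, Matrix.submatrix_apply]
  generalize splitIdx n p i = s
  generalize splitIdx n p j = t
  rcases s with s | s <;> rcases t with t | t
  · simp [splitMetric, fibreForm, baseForm_inl, Pi.single_apply, -Fintype.sum_sum_type]
  · simp [splitMetric, fibreForm, baseForm_inl, -Fintype.sum_sum_type]
  · simp [splitMetric, fibreForm, baseForm_inl_right, -Fintype.sum_sum_type]
  · simp [splitMetric, fibreForm, baseForm_inr, ← sum_baseE n p, Matrix.sum_apply,
      -Fintype.sum_sum_type]

lemma torusD_idxForm (G : Matrix (Unit ⊕ Unit) (Unit ⊕ Unit) ℝ)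
    (M : Unit ⊕ Unit → Matrix (BaseIdx n p) (BaseIdx n p) ℝ) :
    torusD G (idxV n p) (idxForm M) = fun m i j =>
      torusD G (fibreForm (BaseIdx n p)) (fun b => baseForm (Unit ⊕ Unit) (M b))
        (splitIdx n p m) (splitIdx n p i) (splitIdx n p j) := rfl

lemma torusD2_idxForm (G : Matrix (Unit ⊕ Unit) (Unit ⊕ Unit) ℝ)
    (M N : Unit ⊕ Unit → Matrix (BaseIdx n p) (BaseIdx n p) ℝ) :
    torusD2 G (idxForm M) (idxForm N) = fun m k i j =>
      torusD2 G (fun b => baseForm (Unit ⊕ Unit) (M b)) (fun b => baseForm (Unit ⊕ Unit) (N b))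
        (splitIdx n p m) (splitIdx n p k) (splitIdx n p i) (splitIdx n p j) := rfl

lemma coordMetric_zero (c : ℝ) : coordMetric a c A B 0
    = (splitMetric n p a c).submatrix (splitIdx n p) (splitIdx n p) := by
  ext i j
  exact (hasJet_coordMetric a A B c i j).value

/-- The Ricci tensor of `g(a,c)` at the centre of the chart, in the basis `X¹, X², Y¹, Y²`. -/
lemma ricci_coordMetric (hc : c ≠ 0) :
    ricci (coordMetric a c A B) 0 = (Matrix.fromBlocks
      (fibreMetric a c * Matrix.diagonal (fun b => (baseE n p b).trace) * fibreMetric a c) 0 0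
      (∑ b, ((baseE n p b).trace + 2 - 2 * fibreMetric a c b b) • baseE n p b)).submatrix
        (splitIdx n p) (splitIdx n p) := by
  have hdet : ((splitMetric n p a c).submatrix (splitIdx n p) (splitIdx n p)).det ≠ 0 := by
    rw [Matrix.det_submatrix_equiv_self]
    exact splitMetric_det_ne_zero n p a hc
  have hE : ∀ b, (baseE n p b)ᵀ = baseE n p b := by
    rintro (b | b) <;> simp [baseE, Matrix.fromBlocks_transpose]
  have hEE : ∀ b, baseE n p b * baseE n p b = baseE n p b := by
    rintro (b | b) <;> simp [baseE, Matrix.fromBlocks_multiply]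
  have hJ : ∀ b, (baseJ n p b)ᵀ = -baseJ n p b := by
    rintro (b | b) <;> simp [baseJ, Matrix.fromBlocks_transpose, Matrix.fromBlocks_neg,
      imForm_transpose]
  have hJJ : ∀ b d, baseJ n p b * (baseJ n p d)ᵀ = if b = d then baseE n p b else 0 := by
    rintro (b | b) (d | d) <;> simp [baseJ, baseE, Matrix.fromBlocks_transpose,
      Matrix.fromBlocks_multiply, imForm_mul_transpose]
  rw [← jetRicci_torusMetric (fibreMetric_transpose a c) (fibreMetric_det_ne_zero a hc) hE hEE hJ
    hJJ, ← splitMetric_inv n p a hc]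
  ext j k
  rw [ricci_of_jet (hasJet_coordMetric a A B c) hdet, Matrix.inv_submatrix_equiv, torusD_idxForm,
    torusD2_idxForm, jetRicci_reindex, Matrix.submatrix_apply, Matrix.of_apply]

end Charts

/-- The vertical part of the Ricci tensor. -/
lemma fibreRicci_eq (n p : ℕ) (a : ℝ) {c : ℝ} (hc : c ≠ 0) :
    fibreMetric a c * Matrix.diagonal (fun b => (baseE n p b).trace) * fibreMetric a c
      = Matrix.fromBlocks
        (Matrix.of fun _ _ => 2 * ((n + p * a ^ 2) / c ^ 2))
        (Matrix.of fun _ _ => -2 * (a / c ^ 2) * (n + p * (a ^ 2 + c ^ 2)))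
        (Matrix.of fun _ _ => -2 * (a / c ^ 2) * (n + p * (a ^ 2 + c ^ 2)))
        (Matrix.of fun _ _ => 2 * ((n * a ^ 2 + p * (a ^ 2 + c ^ 2) ^ 2) / c ^ 2)) := by
  ext i j
  rcases i with ⟨⟩ | ⟨⟩ <;> rcases j with ⟨⟩ | ⟨⟩ <;>
    simp [fibreMetric, Matrix.mul_apply, trace_baseE_inl, trace_baseE_inr] <;>
    field_simp <;> ring

lemma baseRicci_eq (n p : ℕ) (a c : ℝ) :
    ∑ b, ((baseE n p b).trace + 2 - 2 * fibreMetric a c b b) • baseE n p b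
      = Matrix.fromBlocks ((2 * (1 + n - 1 / c)) • 1) 0 0
          ((2 * (1 + p - (a ^ 2 + c ^ 2) / c)) • 1) := by
  rw [sum_smul_baseE, trace_baseE_inl, trace_baseE_inr]
  congr 2 <;> simp [fibreMetric] <;> ring

/-! ### Eigenvalues -/

lemma charpoly_smul_one {m : Type*} [Fintype m] [DecidableEq m] (r : ℝ) :
    (r • (1 : Matrix m m ℝ)).charpoly = (Polynomial.X - Polynomial.C r) ^ Fintype.card m := by
  rw [Matrix.smul_one_eq_diagonal, Matrix.charpoly_diagonal, Finset.prod_const, Finset.card_univ]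

lemma charpoly_symm_two (x y z : ℝ) :
    (Matrix.fromBlocks (Matrix.of fun _ _ => x) (Matrix.of fun _ _ => z)
      (Matrix.of fun _ _ => z) (Matrix.of fun _ _ => y) :
        Matrix (Unit ⊕ Unit) (Unit ⊕ Unit) ℝ).charpoly
      = (Polynomial.X - Polynomial.C ((x + y + √((x - y) ^ 2 + 4 * z ^ 2)) / 2))
        * (Polynomial.X - Polynomial.C ((x + y - √((x - y) ^ 2 + 4 * z ^ 2)) / 2)) := by
  have hs : √((x - y) ^ 2 + 4 * z ^ 2) ^ 2 = (x - y) ^ 2 + 4 * z ^ 2 :=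
    Real.sq_sqrt (by positivity)
  set s := √((x - y) ^ 2 + 4 * z ^ 2)
  let e : Unit ⊕ Unit ≃ Fin 2 := Equiv.boolEquivPUnitSumPUnit.symm.trans finTwoEquiv.symm
  have h : Matrix.reindex e e
      (Matrix.fromBlocks (Matrix.of fun _ _ => x) (Matrix.of fun _ _ => z)
        (Matrix.of fun _ _ => z) (Matrix.of fun _ _ => y) :
        Matrix (Unit ⊕ Unit) (Unit ⊕ Unit) ℝ) = !![x, z; z, y] := by
    ext i j
    fin_cases i <;> fin_cases j <;> rfl
  rw [← Matrix.charpoly_reindex e, h, Matrix.charpoly_fin_two]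
  have h1 : (!![x, z; z, y] : Matrix (Fin 2) (Fin 2) ℝ).trace
      = (x + y + s) / 2 + (x + y - s) / 2 := by
    simp [Matrix.trace_fin_two]
    ring
  have h2 : (!![x, z; z, y] : Matrix (Fin 2) (Fin 2) ℝ).det
      = (x + y + s) / 2 * ((x + y - s) / 2) := by
    simp [Matrix.det_fin_two]
    linear_combination (1 / 4) * hs
  rw [h1, h2, Polynomial.C_mul, Polynomial.C_add]
  ring

lemma roots_charpoly_block (n p : ℕ) (x y z r s : ℝ) :
    (Matrix.fromBlocks (Matrix.fromBlocks (Matrix.of fun _ _ => x) (Matrix.of fun _ _ => z)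
      (Matrix.of fun _ _ => z) (Matrix.of fun _ _ => y) :
        Matrix (Unit ⊕ Unit) (Unit ⊕ Unit) ℝ) 0 0 (Matrix.fromBlocks (r • 1) 0 0 (s • 1) :
        Matrix (BaseIdx n p) (BaseIdx n p) ℝ)).charpoly.roots
      = {(x + y + √((x - y) ^ 2 + 4 * z ^ 2)) / 2, (x + y - √((x - y) ^ 2 + 4 * z ^ 2)) / 2}
          + Multiset.replicate (2 * n) r + Multiset.replicate (2 * p) s := by
  rw [Matrix.charpoly_fromBlocks_zero₂₁, Matrix.charpoly_fromBlocks_zero₂₁, charpoly_smul_one,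
    charpoly_smul_one, charpoly_symm_two]
  have h0 : ∀ u : ℝ, Polynomial.X - Polynomial.C u ≠ 0 := Polynomial.X_sub_C_ne_zero
  rw [Polynomial.roots_mul (by simp [h0]), Polynomial.roots_mul (by simp [h0]),
    Polynomial.roots_mul (by simp [h0]), Polynomial.roots_pow, Polynomial.roots_pow,
    Polynomial.roots_X_sub_C, Polynomial.roots_X_sub_C, Polynomial.roots_X_sub_C,
    Polynomial.roots_X_sub_C, Multiset.nsmul_singleton, Multiset.nsmul_singleton, ← add_assoc]
  simp [mul_comm]

lemma sum_sum_submatrix {ι κ : Type*} [Fintype ι] [Fintype κ] (e : ι ≃ κ) (M N : Matrix κ κ ℝ) :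
    ∑ i, ∑ j, M.submatrix e e i j * N.submatrix e e i j = ∑ i, ∑ j, M i j * N i j := by
  simp only [Matrix.submatrix_apply, ← e.sum_comp]

end SphereProduct

end

open SphereProduct in
theorem proposition2 (n p : ℕ) (a c : ℝ) (hc : 0 < c)
    (A : Matrix.unitaryGroup (Fin (n + 1)) ℂ) (B : Matrix.unitaryGroup (Fin (p + 1)) ℂ)
    (x y z : ℝ)
    (hx : x = 2 * ((n + p * a ^ 2) / c ^ 2))
    (hy : y = 2 * ((n * a ^ 2 + p * (a ^ 2 + c ^ 2) ^ 2) / c ^ 2))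
    (hz : z = -2 * (a / c ^ 2) * (n + p * (a ^ 2 + c ^ 2))) :
    ricci (coordMetric a c A B) 0 =
        Matrix.fromBlocks
          (corner x ((2 * (1 + n - 1 / c)) • (1 : Matrix (Fin n × Fin 2) (Fin n × Fin 2) ℝ)))
          (corner z 0)
          (corner z 0)
          (corner y ((2 * (1 + p - (a ^ 2 + c ^ 2) / c)) •
            (1 : Matrix (Fin p × Fin 2) (Fin p × Fin 2) ℝ))) ∧
      (ricci (coordMetric a c A B) 0).charpoly.roots =
        {(x + y + √((x - y) ^ 2 + 4 * z ^ 2)) / 2, (x + y - √((x - y) ^ 2 + 4 * z ^ 2)) / 2}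
          + Multiset.replicate (2 * n) (2 * (1 + n - 1 / c))
          + Multiset.replicate (2 * p) (2 * (1 + p - (a ^ 2 + c ^ 2) / c)) ∧
      scalarCurv (coordMetric a c A B) 0 =
        4 * n * (1 + n - 1 / (2 * c)) + 4 * p * (1 + p - (a ^ 2 + c ^ 2) / (2 * c)) := by
  have hric := ricci_coordMetric a A B hc.ne'
  rw [fibreRicci_eq n p a hc.ne', baseRicci_eq, ← hx, ← hy, ← hz] at hric
  refine ⟨?_, ?_, ?_⟩
  · rw [hric]
    ext i j
    rcases i with (i | i) | (i | i) <;> rcases j with (j | j) | (j | j) <;>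
      simp [splitIdx, corner]
  · rw [hric, ← roots_charpoly_block]
    exact congrArg Polynomial.roots (Matrix.charpoly_reindex (splitIdx n p).symm _)
  · rw [scalarCurv, hric, coordMetric_zero, Matrix.inv_submatrix_equiv,
      splitMetric_inv _ _ _ hc.ne', fibreMetric_inv _ hc.ne']
    rw [sum_sum_submatrix]
    simp [fibreInv, Matrix.one_apply]
    rw [hx, hy, hz]
    field_simp
    ring
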